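/- Let $q\ge 2$ and let $\mathbb{HP}^q$ be the quaternionic projective space, a smooth manifold of real dimension $4q$, equipped with its standard (quaternionic Kähler) Riemannian metric $g$, normalised so that the Hopf map from the unit sphere $S^{4q+3}\subset\mathbb H^{q+1}$ to $\mathbb{HP}^q$ is a Riemannian submersion. Then $\mathbb{HP}^q$ admits no local orthogonal coordinates: there is no system of smooth local coordinates $x_1,\dots,x_{4q}$, defined on a non-empty open subset $\mathcal U$ of $\mathbb{HP}^q$, such that $g\left(\frac{\partial}{\partial x_i},\frac{\partial}{\partial x_j}\right)=0$ on $\mathcal U$ for all $i\ne j$. -/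

import Mathlib

open scoped Quaternion Manifold ContDiff

noncomputable section

/-- The quaternionic space `ℍⁿ`, with its standard real Euclidean inner product. -/
abbrev QSpace (n : ℕ) : Type := PiLp 2 (fun _ : Fin n => ℍ)

/-- The real vector space structure underlying the normed space structure (a shortcut for instance
search). -/
instance (n : ℕ) : Module ℝ (QSpace n) := NormedSpace.toModule

/-- The quaternionic projective space `ℍP^q`: nonzero vectors of `ℍ^(q+1)` modulo left
multiplication by nonzero quaternions. -/
def QProj (q : ℕ) : Type := Projectivization ℍ (QSpace (q + 1))

namespace QProj

variable {q : ℕ}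

/-- The canonical projection `π : ℍ^(q+1) ∖ {0} → ℍP^q`. -/
def mk (v : {v : QSpace (q + 1) // v ≠ 0}) : QProj q := Projectivization.mk' ℍ v

/-- The quotient topology. -/
instance : TopologicalSpace (QProj q) := TopologicalSpace.coinduced mk inferInstance

lemma mk_surjective : Function.Surjective (mk (q := q)) := Quotient.mk''_surjective

lemma isQuotientMap_mk : Topology.IsQuotientMap (mk (q := q)) := ⟨⟨rfl⟩, mk_surjective⟩

lemma mk_eq_mk_iff (v w : {v : QSpace (q + 1) // v ≠ 0}) :
    mk v = mk w ↔ ∃ a : ℍ, a • (w : QSpace (q + 1)) = v :=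
  Projectivization.mk_eq_mk_iff' ℍ v.1 w.1 v.2 w.2

/-! ### Affine charts -/

/-- The real linear inclusion `ℍ^q → ℍ^(q+1)` as the hyperplane where the `i`-th coordinate is
zero. -/
def ins (i : Fin (q + 1)) : QSpace q →L[ℝ] QSpace (q + 1) :=
  LinearMap.toContinuousLinearMap
    { toFun := fun x => WithLp.toLp 2 (i.insertNth (α := fun _ => ℍ) 0 x)
      map_add' := fun x y => by
        ext1 k
        induction k using Fin.succAboveCases i <;> simp
      map_smul' := fun c x => by
        ext1 k
        induction k using Fin.succAboveCases i <;> simp }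

@[simp] lemma ins_same (i : Fin (q + 1)) (x : QSpace q) : ins i x i = 0 := by simp [ins]

@[simp] lemma ins_succAbove (i : Fin (q + 1)) (x : QSpace q) (k : Fin q) :
    ins i x (i.succAbove k) = x k := by simp [ins]

/-- The affine section `ℍ^q → ℍ^(q+1)`, which inserts the entry `1` at the position `i`. -/
def sec (i : Fin (q + 1)) (x : QSpace q) : QSpace (q + 1) :=
  WithLp.toLp 2 (i.insertNth (α := fun _ => ℍ) 1 x)

@[simp] lemma sec_same (i : Fin (q + 1)) (x : QSpace q) : sec i x i = 1 := by simp [sec]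

@[simp] lemma sec_succAbove (i : Fin (q + 1)) (x : QSpace q) (k : Fin q) :
    sec i x (i.succAbove k) = x k := by simp [sec]

lemma sec_ne_zero (i : Fin (q + 1)) (x : QSpace q) : sec i x ≠ 0 := fun h => by
  have := sec_same i x
  rw [h] at this
  simp at this

lemma sec_eq (i : Fin (q + 1)) (x : QSpace q) : sec i x = ins i x + sec i 0 := by
  ext1 k
  induction k using Fin.succAboveCases i <;> simp

lemma contDiff_sec (i : Fin (q + 1)) {n : ℕ∞ω} : ContDiff ℝ n (sec i) := by
  rw [funext (sec_eq i)]
  exact (ins i).contDiff.add contDiff_const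

lemma hasFDerivAt_sec (i : Fin (q + 1)) (x : QSpace q) : HasFDerivAt (sec i) (ins i) x := by
  rw [funext (sec_eq i)]
  exact (ins i).hasFDerivAt.add_const _

/-- The affine coordinates of a vector, `v ↦ (vᵢ⁻¹ vₖ)` with `k ≠ i`. -/
def aff (i : Fin (q + 1)) (v : QSpace (q + 1)) : QSpace q :=
  WithLp.toLp 2 (fun k => (v i)⁻¹ * v (i.succAbove k))

@[simp] lemma aff_apply (i : Fin (q + 1)) (v : QSpace (q + 1)) (k : Fin q) :
    aff i v k = (v i)⁻¹ * v (i.succAbove k) := rfl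

@[simp] lemma aff_sec (i : Fin (q + 1)) (x : QSpace q) : aff i (sec i x) = x := by
  ext1 k
  simp

lemma sec_aff (i : Fin (q + 1)) (v : QSpace (q + 1)) (hv : v i ≠ 0) :
    sec i (aff i v) = (v i)⁻¹ • v := by
  ext1 k
  induction k using Fin.succAboveCases i <;> simp [hv]

lemma contDiffOn_aff (i : Fin (q + 1)) {n : ℕ∞ω} : ContDiffOn ℝ n (aff i) {v | v i ≠ 0} := by
  intro v hv
  apply ContDiffAt.contDiffWithinAt
  have hc : ∀ k : Fin (q + 1), ContDiffAt ℝ n (fun v : QSpace (q + 1) => v k) v := fun k =>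
    (PiLp.proj (𝕜 := ℝ) 2 (fun _ : Fin (q + 1) => ℍ) k).contDiff.contDiffAt
  have hinv : ContDiffAt ℝ n (fun v : QSpace (q + 1) => (v i)⁻¹) v := by
    have h := contDiffAt_ringInverse (n := n) ℝ (Units.mk0 (v i) hv)
    rw [Ring.inverse_eq_inv'] at h
    exact ContDiffAt.comp v h (hc i)
  rw [contDiffAt_piLp]
  intro k
  exact hinv.mul (hc _)

/-- The `i`-th affine coordinates on `ℍP^q`, `[v] ↦ (vᵢ⁻¹ vₖ)` with `k ≠ i`. -/
def coord (i : Fin (q + 1)) : QProj q → QSpace q :=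
  Projectivization.lift (fun v => aff i v) (by
    rintro a b t h
    have ht : t ≠ 0 := fun h0 => a.2 (by rw [h, h0, zero_smul])
    ext1 k
    simp only [h, aff_apply, PiLp.smul_apply, smul_eq_mul, mul_inv_rev]
    rw [mul_assoc, inv_mul_cancel_left₀ ht])

@[simp] lemma coord_mk (i : Fin (q + 1)) (v : {v : QSpace (q + 1) // v ≠ 0}) :
    coord i (mk v) = aff i v := rfl

/-- The domain `{[v] | vᵢ ≠ 0}` of the `i`-th affine chart. -/
def dom (i : Fin (q + 1)) : Set (QProj q) := mk '' {v | v.1 i ≠ 0}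

@[simp] lemma mk_mem_dom (i : Fin (q + 1)) (v : {v : QSpace (q + 1) // v ≠ 0}) :
    mk v ∈ dom i ↔ v.1 i ≠ 0 := by
  refine ⟨?_, fun h => ⟨v, h, rfl⟩⟩
  rintro ⟨w, hw, h⟩ h0
  obtain ⟨a, ha⟩ := (mk_eq_mk_iff w v).1 h
  apply hw
  rw [← ha]
  simp [h0]

lemma isOpen_dom (i : Fin (q + 1)) : IsOpen (dom (q := q) i) := by
  rw [← isQuotientMap_mk.isOpen_preimage]
  have : mk ⁻¹' dom (q := q) i = {v | v.1 i ≠ 0} := by ext v; simp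
  rw [this]
  apply isOpen_ne_fun _ continuous_const
  exact (PiLp.continuous_apply 2 (fun _ : Fin (q + 1) => ℍ) i).comp continuous_subtype_val

/-- The `i`-th affine chart of `ℍP^q`. Its inverse is `x ↦ [x₁ : … : 1 : … : x_q]`. -/
def chart (i : Fin (q + 1)) : OpenPartialHomeomorph (QProj q) (QSpace q) where
  toFun := coord i
  invFun x := mk ⟨sec i x, sec_ne_zero i x⟩
  source := dom i
  target := Set.univ
  map_source' _ _ := trivial
  map_target' x _ := by simp
  left_inv' p hp := by
    obtain ⟨v, hv, rfl⟩ := hp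
    rw [mk_eq_mk_iff]
    exact ⟨(v.1 i)⁻¹, (sec_aff i v.1 hv).symm⟩
  right_inv' x _ := by simp
  open_source := isOpen_dom i
  open_target := isOpen_univ
  continuousOn_toFun := by
    rw [isQuotientMap_mk.continuousOn_isOpen_iff (isOpen_dom i)]
    refine (contDiffOn_aff (n := 0) i).continuousOn.comp
      (f := fun v : {v : QSpace (q + 1) // v ≠ 0} => v.1)
      continuous_subtype_val.continuousOn ?_
    intro v hv
    simpa using hv
  continuousOn_invFun := by
    apply Continuous.continuousOn
    apply isQuotientMap_mk.continuous.comp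
    exact Continuous.subtype_mk (contDiff_sec (n := 0) i).continuous _

lemma exists_mem_dom (p : QProj q) : ∃ i, p ∈ dom i := by
  obtain ⟨v, rfl⟩ := mk_surjective p
  simp only [mk_mem_dom]
  by_contra! h
  exact v.2 (by ext1 k; simpa using h k)

/-- A choice of an affine chart around each point. -/
def idx (p : QProj q) : Fin (q + 1) := (exists_mem_dom p).choose

lemma mem_dom_idx (p : QProj q) : p ∈ dom (idx p) := (exists_mem_dom p).choose_spec

/-- The atlas of `ℍP^q` that consists of the `q + 1` affine charts. -/
instance : ChartedSpace (QSpace q) (QProj q) where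
  atlas := Set.range chart
  chartAt p := chart (idx p)
  mem_chart_source := mem_dom_idx
  chart_mem_atlas p := ⟨idx p, rfl⟩

lemma contDiffOn_transition (i j : Fin (q + 1)) {n : ℕ∞ω} :
    ContDiffOn ℝ n (fun x => aff j (sec i x)) {x | sec i x j ≠ 0} :=
  (contDiffOn_aff j).comp (contDiff_sec i).contDiffOn fun _ h => h

instance : IsManifold 𝓘(ℝ, QSpace q) ∞ (QProj q) := by
  apply isManifold_of_contDiffOn
  rintro _ _ ⟨i, rfl⟩ ⟨j, rfl⟩
  refine (contDiffOn_transition i j).mono ?_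
  rintro x ⟨hx, -⟩
  have : mk ⟨sec i x, sec_ne_zero i x⟩ ∈ dom j := hx.2
  simpa using this

/-! ### The standard metric -/

/-- The quaternionic Hermitian product `∑ₖ vₖ w̄ₖ`. -/
def herm (v w : QSpace q) : ℍ := ∑ k, v k * star (w k)

lemma herm_add (X Y v : QSpace q) : herm (X + Y) v = herm X v + herm Y v := by
  simp only [herm, PiLp.add_apply, add_mul, Finset.sum_add_distrib]

lemma herm_smul (c : ℝ) (X v : QSpace q) : herm (c • X) v = c • herm X v := by
  simp only [herm, PiLp.smul_apply, smul_mul_assoc, ← Finset.smul_sum]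

/-- For `v ≠ 0`, the orthogonal projection of `ℍ^q` onto the orthogonal complement of the
quaternionic line `ℍ v`. -/
def hor (v : QSpace q) : QSpace q →L[ℝ] QSpace q :=
  LinearMap.toContinuousLinearMap
    { toFun := fun X => X - (‖v‖ ^ 2)⁻¹ • herm X v • v
      map_add' := fun X Y => by
        rw [herm_add, add_smul, smul_add]
        abel
      map_smul' := fun c X => by
        rw [herm_smul, smul_assoc, smul_comm _ c, RingHom.id_apply, smul_sub] }

lemma hor_apply (v X : QSpace q) : hor v X = X - (‖v‖ ^ 2)⁻¹ • herm X v • v := rfl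

lemma herm_self (v : QSpace q) : herm v v = ((‖v‖ ^ 2 : ℝ) : ℍ) := by
  rw [PiLp.norm_sq_eq_of_L2]
  simp only [herm, Quaternion.self_mul_star, Quaternion.normSq_eq_norm_mul_self, ← sq]
  exact (map_sum (algebraMap ℝ ℍ) _ _).symm

lemma herm_smul_add (a b : ℍ) (v X : QSpace q) :
    herm (a • X + b • v) (a • v) = (a * herm X v + b * herm v v) * star a := by
  simp only [herm, PiLp.add_apply, PiLp.smul_apply, smul_eq_mul, StarMul.star_mul, add_mul,
    Finset.sum_add_distrib, Finset.mul_sum, Finset.sum_mul, mul_assoc]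

lemma hor_smul (a b : ℍ) (ha : a ≠ 0) (v X : QSpace q) (hv : v ≠ 0) :
    hor (a • v) (a • X + b • v) = a • hor v X := by
  have hv' : ‖v‖ ≠ 0 := norm_ne_zero_iff.2 hv
  have ha' : ‖a‖ ≠ 0 := norm_ne_zero_iff.2 ha
  have h1 : star a * a = ((‖a‖ ^ 2 : ℝ) : ℍ) := by
    rw [Quaternion.star_mul_self, Quaternion.normSq_eq_norm_mul_self, sq]
  have key : (‖a • v‖ ^ 2)⁻¹ • herm (a • X + b • v) (a • v) • a • v
      = (‖v‖ ^ 2)⁻¹ • (a * herm X v) • v + b • v := by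
    rw [herm_smul_add, smul_smul _ a v, mul_assoc _ (star a) a, h1, herm_self, norm_smul, mul_pow]
    rw [← Quaternion.coe_commutes, Quaternion.coe_mul_eq_smul, ← smul_assoc, smul_smul,
      ← Quaternion.coe_commutes, Quaternion.coe_mul_eq_smul, smul_add, smul_smul, add_smul,
      smul_assoc]
    congr 1
    · congr 1
      field_simp
    · rw [show (‖a‖ ^ 2 * ‖v‖ ^ 2)⁻¹ * ‖a‖ ^ 2 * ‖v‖ ^ 2 = 1 by field_simp, one_smul]
  rw [hor_apply, hor_apply, key, smul_sub, smul_comm a, smul_smul a]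
  abel

lemma inner_smul_smul (a : ℍ) (x y : QSpace q) :
    inner ℝ (a • x) (a • y) = ‖a‖ ^ 2 * inner ℝ x y := by
  have h : ∀ z : QSpace q, ‖a • z‖ = ‖a‖ * ‖z‖ := fun z => norm_smul a z
  rw [real_inner_eq_norm_add_mul_self_sub_norm_mul_self_sub_norm_mul_self_div_two,
    real_inner_eq_norm_add_mul_self_sub_norm_mul_self_sub_norm_mul_self_div_two, ← smul_add,
    h, h, h]
  ring

/-- The horizontal form at a nonzero vector `v` of `ℍ^(q+1)`: the pull-back of the standard metric
of `ℍP^q` by the canonical projection, `(X, Y) ↦ ⟨Xʰ, Yʰ⟩ / ‖v‖²` with `h` the projection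
orthogonal to `ℍ v`. In restriction to the unit sphere it expresses that the Hopf map
`S^(4q+3) → ℍP^q` is a Riemannian submersion. -/
def horForm (v : QSpace q) : QSpace q →L[ℝ] QSpace q →L[ℝ] ℝ :=
  (‖v‖ ^ 2)⁻¹ • (innerSL ℝ).bilinearComp (hor v) (hor v)

lemma horForm_apply (v X Y : QSpace q) :
    horForm v X Y = (‖v‖ ^ 2)⁻¹ * inner ℝ (hor v X) (hor v Y) := by
  simp only [horForm, smul_apply, ContinuousLinearMap.bilinearComp_apply,
    innerSL_apply_apply, smul_eq_mul]

lemma horForm_smul (a b c : ℍ) (ha : a ≠ 0) (v X Y : QSpace q) (hv : v ≠ 0) :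
    horForm (a • v) (a • X + b • v) (a • Y + c • v) = horForm v X Y := by
  have ha' : ‖a‖ ≠ 0 := norm_ne_zero_iff.2 ha
  rw [horForm_apply, horForm_apply, hor_smul a b ha v X hv, hor_smul a c ha v Y hv,
    inner_smul_smul, norm_smul]
  field_simp

/-- The standard metric in the `i`-th affine chart, at the point with affine coordinates `x`. -/
def chartForm (i : Fin (q + 1)) (x : QSpace q) : QSpace q →L[ℝ] QSpace q →L[ℝ] ℝ :=
  (horForm (sec i x)).bilinearComp (ins i) (ins i)

lemma chartForm_apply (i : Fin (q + 1)) (x X Y : QSpace q) :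
    chartForm i x X Y = horForm (sec i x) (ins i X) (ins i Y) := rfl

/-- The expressions of the metric in two affine charts correspond under the change of charts. -/
lemma chartForm_transition (i j : Fin (q + 1)) (x X Y : QSpace q) (hx : sec i x j ≠ 0) :
    chartForm j (aff j (sec i x)) (fderiv ℝ (fun x => aff j (sec i x)) x X)
      (fderiv ℝ (fun x => aff j (sec i x)) x Y) = chartForm i x X Y := by
  set T : QSpace q → QSpace q := fun x => aff j (sec i x) with hT
  have hcont : Continuous (fun y => sec i y j) :=
    (PiLp.continuous_apply 2 (fun _ : Fin (q + 1) => ℍ) j).comp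
      (contDiff_sec (n := 0) i).continuous
  have hopen : IsOpen {y | sec i y j ≠ 0} := isOpen_ne_fun hcont continuous_const
  have hTd : HasFDerivAt T (fderiv ℝ T x) x :=
    (((contDiffOn_transition (n := 1) i j).contDiffAt (hopen.mem_nhds hx)).differentiableAt
      one_ne_zero).hasFDerivAt
  have h1 : HasFDerivAt (fun y => sec j (T y)) ((ins j).comp (fderiv ℝ T x)) x :=
    (hasFDerivAt_sec j (T x)).comp x hTd
  have hinv : DifferentiableAt ℝ (fun y => (sec i y j)⁻¹) x := by
    have h := contDiffAt_ringInverse (n := 1) ℝ (Units.mk0 (sec i x j) hx)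
    rw [Ring.inverse_eq_inv'] at h
    have hj : ContDiffAt ℝ 1 (fun y => sec i y j) x :=
      ((PiLp.proj (𝕜 := ℝ) 2 (fun _ : Fin (q + 1) => ℍ) j).contDiff.comp
        (contDiff_sec i)).contDiffAt
    exact (ContDiffAt.comp x h hj).differentiableAt one_ne_zero
  have h2 := hinv.hasFDerivAt.smul (hasFDerivAt_sec i x)
  have heq : (fun y => sec j (T y)) =ᶠ[nhds x] ((fun y => (sec i y j)⁻¹) • sec i) := by
    filter_upwards [hopen.mem_nhds hx] with y hy
    exact sec_aff j _ hy
  have h3 := h1.unique (h2.congr_of_eventuallyEq heq)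
  have h4 : ∀ Z, ins j (fderiv ℝ T x Z) = (sec i x j)⁻¹ • ins i Z
      + (fderiv ℝ (fun y => (sec i y j)⁻¹) x Z) • sec i x := fun Z => by
    have := congrArg (fun A : QSpace q →L[ℝ] QSpace (q + 1) => A Z) h3
    simpa using this
  rw [chartForm_apply, chartForm_apply, h4, h4, show sec j (T x) = _ from sec_aff j _ hx,
    horForm_smul _ _ _ (inv_ne_zero hx) _ _ _ (sec_ne_zero i x)]

/-- Quaternionic conjugation, as a real linear map. -/
def qstar : ℍ →L[ℝ] ℍ :=
  LinearMap.toContinuousLinearMap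
    { toFun := star
      map_add' := star_add
      map_smul' := fun c x => by simp }

lemma contDiff_chartForm (i : Fin (q + 1)) {n : ℕ∞ω} : ContDiff ℝ n (chartForm i) := by
  rw [contDiff_clm_apply_iff]
  intro X
  rw [contDiff_clm_apply_iff]
  intro Y
  have hs := contDiff_sec (n := n) i
  have hne : ∀ x, ‖sec i x‖ ^ 2 ≠ 0 := fun x =>
    pow_ne_zero 2 (norm_ne_zero_iff.2 (sec_ne_zero i x))
  have hN : ContDiff ℝ n (fun x => (‖sec i x‖ ^ 2)⁻¹) := (hs.norm_sq ℝ).inv hne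
  have hh : ∀ Z : QSpace (q + 1), ContDiff ℝ n (fun x => hor (sec i x) Z) := by
    intro Z
    have hZ : ContDiff ℝ n (fun x => herm Z (sec i x)) := by
      refine ContDiff.sum fun k _ => contDiff_const.mul ?_
      exact qstar.contDiff.comp
        ((PiLp.proj (𝕜 := ℝ) 2 (fun _ : Fin (q + 1) => ℍ) k).contDiff.comp hs)
    simp only [hor_apply]
    exact contDiff_const.sub (hN.smul (hZ.smul hs))
  simp only [chartForm_apply, horForm_apply]
  exact hN.mul ((hh _).inner ℝ (hh _))

lemma hor_ins_injective (i : Fin (q + 1)) (x : QSpace q) :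
    LinearMap.ker ((hor (sec i x)).comp (ins i)).toLinearMap = ⊥ := by
  rw [LinearMap.ker_eq_bot']
  intro X hX
  have hX' : ins i X = (‖sec i x‖ ^ 2)⁻¹ • herm (ins i X) (sec i x) • sec i x := by
    have : hor (sec i x) (ins i X) = 0 := hX
    rwa [hor_apply, sub_eq_zero] at this
  rw [← smul_assoc] at hX'
  set c : ℍ := (‖sec i x‖ ^ 2)⁻¹ • herm (ins i X) (sec i x)
  have hc : c = 0 := by
    have := congrArg (fun v : QSpace (q + 1) => v i) hX'
    simpa using this.symm
  rw [hc, zero_smul] at hX'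
  ext1 k
  have := congrArg (fun v : QSpace (q + 1) => v (i.succAbove k)) hX'
  simpa using this

lemma chartForm_bound (i : Fin (q + 1)) (x : QSpace q) :
    ∃ c > 0, ∀ X, c * ‖X‖ ^ 2 ≤ chartForm i x X X := by
  obtain ⟨K, hK, h⟩ := LinearMap.exists_antilipschitzWith _ (hor_ins_injective i x)
  have hs : 0 < ‖sec i x‖ ^ 2 := pow_pos (norm_pos_iff.2 (sec_ne_zero i x)) 2
  have hK' : (0 : ℝ) < K := hK
  refine ⟨(‖sec i x‖ ^ 2)⁻¹ * ((K : ℝ) ^ 2)⁻¹, by positivity, fun X => ?_⟩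
  have h1 : ‖X‖ ≤ K * ‖hor (sec i x) (ins i X)‖ := by
    simpa using h.le_mul_dist X 0
  rw [chartForm_apply, horForm_apply, real_inner_self_eq_norm_sq, mul_assoc]
  refine mul_le_mul_of_nonneg_left ?_ (inv_nonneg.2 hs.le)
  rw [inv_mul_le_iff₀ (by positivity), ← mul_pow]
  exact pow_le_pow_left₀ (norm_nonneg _) h1 2

lemma chartForm_symm (i : Fin (q + 1)) (x X Y : QSpace q) :
    chartForm i x X Y = chartForm i x Y X := by
  rw [chartForm_apply, chartForm_apply, horForm_apply, horForm_apply, real_inner_comm]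

lemma chartForm_pos (i : Fin (q + 1)) (x X : QSpace q) (hX : X ≠ 0) : 0 < chartForm i x X X := by
  obtain ⟨c, hc, h⟩ := chartForm_bound i x
  have := norm_pos_iff.2 hX
  exact lt_of_lt_of_le (by positivity) (h X)

lemma isVonNBounded_chartForm (i : Fin (q + 1)) (x : QSpace q) :
    Bornology.IsVonNBounded ℝ {X : QSpace q | chartForm i x X X < 1} := by
  obtain ⟨c, hc, h⟩ := chartForm_bound i x
  rw [NormedSpace.isVonNBounded_iff, isBounded_iff_forall_norm_le]
  refine ⟨1 + c⁻¹, fun X hX => ?_⟩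
  have h1 : ‖X‖ ^ 2 ≤ c⁻¹ := by
    rw [← one_div, le_div_iff₀' hc]
    exact (h X).trans (le_of_lt hX)
  have := inv_pos.2 hc
  nlinarith [norm_nonneg X]

lemma contMDiffOn_coord (i : Fin (q + 1)) :
    ContMDiffOn 𝓘(ℝ, QSpace q) 𝓘(ℝ, QSpace q) ∞ (coord i) (dom i) :=
  contMDiffOn_of_mem_maximalAtlas (e := chart i)
    (IsManifold.subset_maximalAtlas ⟨i, rfl⟩)

/-- The standard metric of `ℍP^q` at the point `p`. A tangent vector at `p` is represented, as
always, by its components in the preferred chart at `p`. -/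
def metricAt (p : QProj q) :
    TangentSpace 𝓘(ℝ, QSpace q) p →L[ℝ] TangentSpace 𝓘(ℝ, QSpace q) p →L[ℝ] ℝ :=
  (chartForm (idx p) (coord (idx p) p) : QSpace q →L[ℝ] QSpace q →L[ℝ] ℝ)

/-- The expression of the metric in an arbitrary preferred chart. -/
lemma metricAt_tangentCoordChange (p₀ p : QProj q) (hp : p ∈ dom (idx p₀)) (X Y : QSpace q) :
    metricAt p (tangentCoordChange 𝓘(ℝ, QSpace q) p₀ p p X : QSpace q)
      (tangentCoordChange 𝓘(ℝ, QSpace q) p₀ p p Y : QSpace q)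
      = chartForm (idx p₀) (coord (idx p₀) p) X Y := by
  obtain ⟨v, hv, rfl⟩ := hp
  set p := mk v with hpv
  have h0 : sec (idx p₀) (coord (idx p₀) p) (idx p) ≠ 0 := by
    have h1 : v.1 (idx p) ≠ 0 := (mk_mem_dom _ _).1 (mem_dom_idx p)
    rw [hpv, coord_mk, sec_aff _ _ hv]
    simpa using ⟨hv, h1⟩
  have h2 : aff (idx p) (sec (idx p₀) (coord (idx p₀) p)) = coord (idx p) p := by
    have := (chart (idx p₀)).left_inv (x := p) ⟨v, hv, rfl⟩
    exact congrArg (coord (idx p)) this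
  have h3 : tangentCoordChange 𝓘(ℝ, QSpace q) p₀ p p
      = fderiv ℝ (fun x => aff (idx p) (sec (idx p₀) x)) (coord (idx p₀) p) := by
    rw [tangentCoordChange_def, ← fderivWithin_univ]
    simp only [modelWithCornersSelf_coe, Set.range_id]
    rfl
  have h4 := chartForm_transition (idx p₀) (idx p) (coord (idx p₀) p) X Y h0
  rw [h2] at h4
  rw [h3]
  exact h4

lemma contMDiff_metricAt (q : ℕ) : ContMDiff 𝓘(ℝ, QSpace q)
    (𝓘(ℝ, QSpace q).prod 𝓘(ℝ, QSpace q →L[ℝ] QSpace q →L[ℝ] ℝ)) ∞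
    (fun p : QProj q => Bundle.TotalSpace.mk' (QSpace q →L[ℝ] QSpace q →L[ℝ] ℝ)
      (E := fun p : QProj q =>
        TangentSpace 𝓘(ℝ, QSpace q) p →L[ℝ] TangentSpace 𝓘(ℝ, QSpace q) p →L[ℝ] ℝ)
      p (metricAt p)) := by
  intro p₀
  rw [Bundle.contMDiffAt_section]
  have hdom : dom (idx p₀) ∈ nhds p₀ := (isOpen_dom _).mem_nhds (mem_dom_idx p₀)
  have h : ContMDiffAt 𝓘(ℝ, QSpace q) 𝓘(ℝ, QSpace q →L[ℝ] QSpace q →L[ℝ] ℝ) ∞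
      (fun p => chartForm (idx p₀) (coord (idx p₀) p)) p₀ :=
    (contDiff_chartForm (idx p₀)).contMDiff.contMDiffAt.comp p₀
      ((contMDiffOn_coord (idx p₀)).contMDiffAt hdom)
  refine h.congr_of_eventuallyEq ?_
  filter_upwards [hdom] with p hp
  rw [hom_trivializationAt_apply]
  ext X Y
  have hb : p ∈ (trivializationAt (QSpace q)
      (TangentSpace 𝓘(ℝ, QSpace q) : QProj q → Type _) p₀).baseSet := hp
  have hs : ∀ Z : QSpace q, (trivializationAt (QSpace q)
      (TangentSpace 𝓘(ℝ, QSpace q) : QProj q → Type _) p₀).symm p Z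
      = tangentCoordChange 𝓘(ℝ, QSpace q) p₀ p p Z := fun Z => by
    rw [← Bundle.Trivialization.symmL_apply (R := ℝ) _ hb,
      TangentBundle.symmL_trivializationAt_eq_core hp]
    rfl
  rw [inCoordinates_apply_eq₂ hb hb (Set.mem_univ _), hs, hs, ← metricAt_tangentCoordChange p₀ p hp]
  simp

/-- The standard (quaternionic Kähler) Riemannian metric of `ℍP^q`. -/
def metric (q : ℕ) : Bundle.ContMDiffRiemannianMetric 𝓘(ℝ, QSpace q) ∞ (QSpace q)
    (fun p : QProj q => TangentSpace 𝓘(ℝ, QSpace q) p) where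
  inner := metricAt
  symm p := chartForm_symm (idx p) (coord (idx p) p)
  pos p := chartForm_pos (idx p) (coord (idx p) p)
  isVonNBounded p := isVonNBounded_chartForm (idx p) (coord (idx p) p)
  contMDiff := contMDiff_metricAt q

end QProj

/-- The real dimension of `ℍP^q` is `4q`. -/
lemma finrank_qSpace (q : ℕ) : Module.finrank ℝ (QSpace q) = 4 * q := by
  have h : Module.finrank ℝ (QSpace q) = Module.finrank ℝ (Fin q → ℍ) :=
    LinearEquiv.finrank_eq (PiLp.continuousLinearEquiv 2 ℝ (fun _ : Fin q => ℍ)).toLinearEquiv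
  have h4 : Module.finrank ℝ ℍ = 4 :=
    (LinearEquiv.finrank_eq Quaternion.linearIsometryEquivTuple.toLinearEquiv).trans
      (finrank_euclideanSpace_fin (𝕜 := ℝ) (n := 4))
  rw [h, Module.finrank_pi_fintype]
  simp only [Finset.sum_const, Finset.card_univ, Fintype.card_fin, smul_eq_mul]
  rw [mul_comm 4]
  exact congrArg _ h4

/-! ### Orthogonal coordinates on a Riemannian manifold -/

section OrthogonalCoordinates

variable {E H M : Type*} [NormedAddCommGroup E] [NormedSpace ℝ E] [TopologicalSpace H]
  {I : ModelWithCorners ℝ E H} [TopologicalSpace M] [ChartedSpace H M]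

/-- A homeomorphism `φ = (x₁, …, xₙ)` from an open subset of the manifold `M` onto an open subset
of `ℝⁿ` is a system of local coordinates of `M` if it is a smooth diffeomorphism. -/
def IsLocalCoordinates (I : ModelWithCorners ℝ E H) {n : ℕ}
    (φ : OpenPartialHomeomorph M (EuclideanSpace ℝ (Fin n))) : Prop :=
  ContMDiffOn I 𝓘(ℝ, EuclideanSpace ℝ (Fin n)) ∞ φ φ.source ∧
    ContMDiffOn 𝓘(ℝ, EuclideanSpace ℝ (Fin n)) I ∞ φ.symm φ.target

/-- The coordinate vector `∂/∂xᵢ` of the local coordinates `φ = (x₁, …, xₙ)`, at the point with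
coordinates `y`. -/
def coordVector (I : ModelWithCorners ℝ E H) {n : ℕ}
    (φ : OpenPartialHomeomorph M (EuclideanSpace ℝ (Fin n)))
    (i : Fin n) (y : EuclideanSpace ℝ (Fin n)) : TangentSpace I (φ.symm y) :=
  mfderiv 𝓘(ℝ, EuclideanSpace ℝ (Fin n)) I φ.symm y (EuclideanSpace.single i (1 : ℝ))

variable [IsManifold I ∞ M]

/-- `φ = (x₁, …, xₙ)` is a system of orthogonal coordinates of the Riemannian manifold `(M, g)`, on
the open set `φ.source`, if it is a system of local coordinates with
`g (∂/∂xᵢ, ∂/∂xⱼ) = 0` for all `i ≠ j`. -/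
def IsOrthogonalCoordinates
    (g : Bundle.ContMDiffRiemannianMetric I ∞ E (fun p : M => TangentSpace I p)) {n : ℕ}
    (φ : OpenPartialHomeomorph M (EuclideanSpace ℝ (Fin n))) : Prop :=
  IsLocalCoordinates I φ ∧
    ∀ y ∈ φ.target, ∀ i j : Fin n, i ≠ j →
      g.inner (φ.symm y) (coordVector I φ i y) (coordVector I φ j y) = 0

end OrthogonalCoordinates

end

/-! In orthogonal coordinates the curvature tensor vanishes on any four distinct coordinate vectors.
For `ℍP^q` this condition, combined with the Bianchi identity, says that the quaternionic Hermitian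
products `h i j` of the coordinate vectors satisfy `⟨h i j, h k l⟩ = ⟨h i k, h l j⟩` for distinct
indices, and this forces `4q ≤ 4`.

No curvature tensor is computed. The coordinates are lifted to a map `F` into the orthogonal
complement of a quaternionic line `ℍ v`, that is, to an affine chart centred at the base point.
There the metric is conformal to `(‖v‖² + ‖F‖²)⟨X, Y⟩ - ⟨herm X F, herm Y F⟩`. Differentiating the
orthogonality relations twice at the point where `F = 0`, and eliminating the third derivatives of
`F` by their symmetry, gives the relation on `h` (`inner_bilin_dirDeriv_eq`).

The rest is algebra in `ℍ` (`gram_triple`, `card_le_four_of_gram`). After normalisation, `h` is the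
Gram matrix of a real orthonormal basis of a quaternionic Hermitian space, and each of its rows
spans `ℍ`. Any three distinct indices give imaginary quaternions `a`, `b`, `c` that are pairwise
orthogonal with `a = -bc`. With more than four indices some off-diagonal entry vanishes, and the
curvature relation then prevents a row from spanning. -/

/-! ### Algebra of quaternionic Gram matrices. -/

lemma Quaternion.star_eq_neg_of_re_eq_zero {a : ℍ} (ha : a.re = 0) : star a = -a :=
  Quaternion.star_eq_neg.2 ha

/-- Orthogonality to `1` and to `a` imposes at most two linear conditions in dimension four. Such an
`x` contradicts the spanning property of a row whose imaginary entries are all parallel to `a`. -/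
lemma Quaternion.exists_re_eq_zero_and_inner_eq_zero (a : ℍ) :
    ∃ x : ℍ, x ≠ 0 ∧ x.re = 0 ∧ (inner ℝ a x : ℝ) = 0 := by
  classical
  let S : Submodule ℝ ℍ := Submodule.span ℝ (({1, a} : Finset ℍ) : Set ℍ)
  have hS : Module.finrank ℝ S ≤ 2 := (finrank_span_finset_le_card _).trans Finset.card_le_two
  have h1 := S.finrank_add_finrank_orthogonal
  rw [Quaternion.finrank_eq_four] at h1
  have hne : Sᗮ ≠ ⊥ := by
    intro h
    rw [h, finrank_bot] at h1
    lia
  obtain ⟨x, hx, hx0⟩ := Submodule.exists_mem_ne_zero_of_ne_bot hne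
  have hmem : ∀ b ∈ ({1, a} : Finset ℍ), (inner ℝ b x : ℝ) = 0 := fun b hb =>
    (Submodule.mem_orthogonal S x).1 hx b (Submodule.subset_span hb)
  refine ⟨x, hx0, ?_, hmem a (by simp)⟩
  simpa [Quaternion.inner_def] using hmem 1 (by simp)

/-- In a family `h` of quaternions that behaves like the Gram matrix of a real orthonormal basis of
a quaternionic Hermitian space, the entries of three distinct indices are tied by this relation
when the symmetrised products of entries with distinct indices agree. -/
lemma gram_triple {ι : Type*} [Fintype ι] [DecidableEq ι] {h : ι → ι → ℍ}
    (h_self : ∀ i, h i i = 1) (h_re : ∀ i j, i ≠ j → (h i j).re = 0)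
    (h_anti : ∀ i j, i ≠ j → h j i = -h i j)
    (h_sum : ∀ j k x, ∑ l, (inner ℝ (h l j) x : ℝ) • h k l = h k j * star x)
    (h_curv : ∀ i j k l, i ≠ j → i ≠ k → i ≠ l → j ≠ k → j ≠ l → k ≠ l →
      (inner ℝ (h i j) (h k l) : ℝ) = inner ℝ (h i k) (h l j))
    {i j k : ι} (hij : i ≠ j) (hik : i ≠ k) (hjk : j ≠ k) :
    h i j = (2 * inner ℝ (h i j) (h k i) : ℝ) • h k i + (inner ℝ (h i j) (h j k) : ℝ) • h j k
      - (h j k * h k i + ((inner ℝ (h j k) (h k i) : ℝ) : ℍ)) := by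
  have hone : ∀ a b : ι, a ≠ b → (inner ℝ (1 : ℍ) (h a b) : ℝ) = 0 := fun a b hab => by
    simp [Quaternion.inner_def, h_re a b hab]
  have hsplit : ∀ f : ι → ℍ, ∑ l, f l = f i + f j + f k + ∑ l ∈ ({i, j, k} : Finset ι)ᶜ, f l := by
    intro f
    rw [← Finset.sum_add_sum_compl ({i, j, k} : Finset ι)]
    rw [Finset.sum_insert (by simp [hij, hik]), Finset.sum_insert (by simp [hjk]),
      Finset.sum_singleton]
    simp only [add_assoc]
  -- These two instances are chosen so that, on adding them, the terms with `l` outside `{i, j, k}`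
  -- cancel by `h_curv`; only the entries of the triple remain.
  have s1 := h_sum k k (h i j)
  have s2 := h_sum j k (h i k)
  rw [hsplit] at s1 s2
  have hrest : ∑ l ∈ ({i, j, k} : Finset ι)ᶜ, (inner ℝ (h l k) (h i j) : ℝ) • h k l
      = - ∑ l ∈ ({i, j, k} : Finset ι)ᶜ, (inner ℝ (h l j) (h i k) : ℝ) • h k l := by
    rw [← Finset.sum_neg_distrib]
    refine Finset.sum_congr rfl fun l hl => ?_
    simp only [Finset.mem_compl, Finset.mem_insert, Finset.mem_singleton, not_or] at hl
    obtain ⟨hli, hlj, hlk⟩ := hl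
    rw [h_anti k l (Ne.symm hlk), inner_neg_left, real_inner_comm,
      h_curv i j k l hij hik (Ne.symm hli) hjk (Ne.symm hlj) (Ne.symm hlk), real_inner_comm,
      neg_smul]
  rw [hrest, h_self, hone i j hij, zero_smul,
    Quaternion.star_eq_neg_of_re_eq_zero (h_re i j hij), one_mul] at s1
  rw [h_self, hone i k hik, zero_smul,
    Quaternion.star_eq_neg_of_re_eq_zero (h_re i k hik), h_self] at s2
  rw [h_anti j k hjk, h_anti k i hik.symm] at s2
  rw [h_anti k i hik.symm, h_anti j k hjk] at s1
  simp only [inner_neg_left, inner_neg_right, neg_mul, neg_neg] at s1 s2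
  rw [real_inner_comm (h i j) (h j k), real_inner_comm (h i j) (h k i)] at s1
  have e : ((inner ℝ (h j k) (h k i) : ℝ) : ℍ) = (inner ℝ (h j k) (h k i) : ℝ) • (1 : ℍ) := by
    rw [← Quaternion.coe_mul_eq_smul, mul_one]
  rw [e]
  linear_combination (norm := module) s1 + s2

/-- Such a family has at most four members. -/
theorem card_le_four_of_gram {ι : Type*} [Fintype ι] [DecidableEq ι] {h : ι → ι → ℍ}
    (h_self : ∀ i, h i i = 1) (h_re : ∀ i j, i ≠ j → (h i j).re = 0)
    (h_anti : ∀ i j, i ≠ j → h j i = -h i j)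
    (h_sum : ∀ j k x, ∑ l, (inner ℝ (h l j) x : ℝ) • h k l = h k j * star x)
    (h_curv : ∀ i j k l, i ≠ j → i ≠ k → i ≠ l → j ≠ k → j ≠ l → k ≠ l →
      (inner ℝ (h i j) (h k l) : ℝ) = inner ℝ (h i k) (h l j)) :
    Fintype.card ι ≤ 4 := by
  -- Each row is a Parseval frame of the imaginary quaternions: `h_sum` on the diagonal, the two
  -- signs from conjugation and from `h_anti` cancelling.
  have hrow : ∀ (i : ι) (x : ℍ), x.re = 0 → x = ∑ l, (inner ℝ (h i l) x : ℝ) • h i l := by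
    intro i x hx
    have h1 := h_sum i i x
    rw [h_self, one_mul, Quaternion.star_eq_neg_of_re_eq_zero hx] at h1
    refine (neg_eq_iff_eq_neg.1 h1.symm).trans ?_
    rw [← Finset.sum_neg_distrib]
    refine Finset.sum_congr rfl fun l _ => ?_
    by_cases hl : i = l
    · subst hl
      simp [h_self, Quaternion.inner_def, hx]
    · rw [h_anti i l hl, inner_neg_left, neg_smul, neg_neg]
  have htri : ∀ i j k : ι, i ≠ j → i ≠ k → j ≠ k → _ := fun i j k hij hik hjk =>
    gram_triple h_self h_re h_anti h_sum h_curv hij hik hjk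
  -- reversing a triple gives a second relation
  have hpar : ∀ i j k : ι, i ≠ j → i ≠ k → j ≠ k →
      (inner ℝ (h i j) (h k i) : ℝ) • h k i = (inner ℝ (h i j) (h j k) : ℝ) • h j k := by
    intro i j k hij hik hjk
    have t1 := htri i j k hij hik hjk
    have t2 := htri j i k hij.symm hjk hik
    rw [h_anti i j hij, h_anti j k hjk, h_anti k i hik.symm] at t2
    -- For imaginary `b`, `c` the quantity `bc + ⟨b, c⟩` is the cross product, hence antisymmetric.
    have hcross : h j k * h k i + ((inner ℝ (h j k) (h k i) : ℝ) : ℍ)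
        = -(h k i * h j k + ((inner ℝ (h k i) (h j k) : ℝ) : ℍ)) := by
      have hb := h_re j k hjk
      have hc := h_re k i hik.symm
      ext <;> simp [Quaternion.inner_def, hb, hc] <;> ring
    simp only [inner_neg_left, inner_neg_right, neg_neg, neg_mul_neg, smul_neg] at t2
    rw [hcross] at t1
    linear_combination (norm := module) -t1 - t2
  -- One orthogonality propagates to all three pairs by `hpar`, and `gram_triple` reduces to `a =
  -- -bc`, cyclically. The three norms are therefore all `0` or all `1`.
  have hnorm : ∀ i j k : ι, i ≠ j → i ≠ k → j ≠ k → (inner ℝ (h i j) (h k i) : ℝ) = 0 →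
      ‖h i j‖ = ‖h j k‖ * ‖h k i‖ ∧ ‖h j k‖ = ‖h k i‖ * ‖h i j‖ ∧ ‖h k i‖ = ‖h i j‖ * ‖h j k‖ := by
    intro i j k hij hik hjk hac
    have hab : (inner ℝ (h i j) (h j k) : ℝ) = 0 := by
      have t := hpar i j k hij hik hjk
      rw [hac, zero_smul, eq_comm, smul_eq_zero] at t
      rcases t with t | t
      · exact t
      · rw [t, inner_zero_right]
    have hbc : (inner ℝ (h j k) (h k i) : ℝ) = 0 := by
      have t := hpar j k i hjk hij.symm hik.symm
      rw [real_inner_comm (h i j), hab, zero_smul, eq_comm, smul_eq_zero] at t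
      rcases t with t | t
      · exact t
      · rw [t, inner_zero_right]
    have hprod : ∀ i j k : ι, i ≠ j → i ≠ k → j ≠ k → (inner ℝ (h i j) (h k i) : ℝ) = 0 →
        (inner ℝ (h i j) (h j k) : ℝ) = 0 → (inner ℝ (h j k) (h k i) : ℝ) = 0 →
        ‖h i j‖ = ‖h j k‖ * ‖h k i‖ := by
      intro i j k hij hik hjk h1 h2 h3
      have t := htri i j k hij hik hjk
      rw [h1, h2, h3] at t
      rw [← norm_mul, ← norm_neg (h j k * h k i)]
      congr 1
      simpa using t
    refine ⟨hprod i j k hij hik hjk hac hab hbc,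
      hprod j k i hjk hij.symm hik.symm ?_ hbc ?_, hprod k i j hik.symm hjk.symm hij ?_ ?_ hab⟩
    · rw [real_inner_comm, hab]
    · rw [real_inner_comm, hac]
    · rw [real_inner_comm, hbc]
    · rw [real_inner_comm, hac]
  -- Here `b` and `c` are parallel by `hpar`, so the cross product drops out; the factor `3` is `2 +
  -- 1`, the two remaining terms being multiples of the same vector.
  have hparallel : ∀ i j k : ι, i ≠ j → i ≠ k → j ≠ k → (inner ℝ (h i j) (h k i) : ℝ) ≠ 0 →
      h i j = (3 * inner ℝ (h i j) (h k i) : ℝ) • h k i := by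
    intro i j k hij hik hjk hac
    have t := hpar i j k hij hik hjk
    have hab : (inner ℝ (h i j) (h j k) : ℝ) ≠ 0 := by
      intro h0
      rw [h0, zero_smul, smul_eq_zero] at t
      rcases t with t | t
      · exact hac t
      · exact hac (by rw [t, inner_zero_right])
    obtain ⟨r, hr⟩ : ∃ r : ℝ, h j k = r • h k i :=
      ⟨(inner ℝ (h i j) (h j k))⁻¹ * inner ℝ (h i j) (h k i), by
        rw [mul_smul, t, inv_smul_smul₀ hab]⟩
    have hcross : h j k * h k i + ((inner ℝ (h j k) (h k i) : ℝ) : ℍ) = 0 := by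
      have hc := h_re k i hik.symm
      rw [hr]
      have hcc : h k i * h k i = -((inner ℝ (h k i) (h k i) : ℝ) : ℍ) := by
        rw [Quaternion.inner_self, ← Quaternion.self_mul_star,
          Quaternion.star_eq_neg_of_re_eq_zero hc, mul_neg, neg_neg]
      rw [real_inner_smul_left, smul_mul_assoc, hcc, Quaternion.coe_mul,
        Quaternion.coe_mul_eq_smul, smul_neg, neg_add_cancel]
    have t1 := htri i j k hij hik hjk
    rw [hcross, ← t] at t1
    linear_combination (norm := module) t1
  have hzero : ∀ i j k : ι, i ≠ j → i ≠ k → j ≠ k → (inner ℝ (h i j) (h k i) : ℝ) = 0 := by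
    intro i j k hij hik hjk
    by_contra hne
    -- Pairing the parallelism relation of the triple `(i, k, j)` with `h j i` and cancelling the
    -- nonzero inner product fixes the norm.
    have hsq : ‖h i j‖ ^ 2 = 1 / 3 := by
      have hne' : (inner ℝ (h i k) (h j i) : ℝ) ≠ 0 := by
        rwa [h_anti i j hij, h_anti k i hik.symm, inner_neg_neg, real_inner_comm]
      have t := hparallel i k j hik hij hjk.symm hne'
      have t2 := congrArg (fun z => (inner ℝ z (h j i) : ℝ)) t
      simp only [inner_smul_left] at t2
      rw [real_inner_self_eq_norm_sq, h_anti i j hij, norm_neg, ← h_anti i j hij] at t2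
      have t3 : (inner ℝ (h i k) (h j i) : ℝ) * (3 * ‖h i j‖ ^ 2 - 1) = 0 := by
        simp only [RCLike.conj_to_real] at t2
        linear_combination -t2
      have := (mul_eq_zero.1 t3).resolve_left hne'
      linarith
    have hmul : ∀ x : ℍ, x.re = 0 → (inner ℝ (h i j) x : ℝ) = 0 → x = 0 := by
      intro x hx hax
      rw [hrow i x hx]
      refine Finset.sum_eq_zero fun l _ => ?_
      by_cases hli : i = l
      · subst hli
        simp [h_self, Quaternion.inner_def, hx]
      by_cases hlj : j = l
      · rw [← hlj, hax, zero_smul]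
      -- The norm of `h i j` is neither `0` nor `1`, so the orthogonal case of `hnorm` is excluded
      -- for every `l`: all imaginary entries of row `i` are parallel to `h i j`, and the row cannot
      -- span.
      have hne2 : (inner ℝ (h i j) (h l i) : ℝ) ≠ 0 := by
        intro h0
        obtain ⟨n1, n2, n3⟩ := hnorm i j l hij hli hlj h0
        have hpos : 0 < ‖h i j‖ := by
          refine (norm_nonneg _).lt_of_ne fun h0 => ?_
          rw [← h0] at hsq
          norm_num at hsq
        have e1 : ‖h i j‖ * (1 - ‖h l i‖ ^ 2) = 0 := by
          rw [n2] at n1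
          linear_combination n1
        have e2 : ‖h l i‖ * (1 - ‖h i j‖ ^ 2) = 0 := by
          rw [n2] at n3
          linear_combination n3
        have e3 := (mul_eq_zero.1 e1).resolve_left hpos.ne'
        have e4 : ‖h l i‖ = 0 := (mul_eq_zero.1 e2).resolve_right (by rw [hsq]; norm_num)
        rw [e4] at e3
        norm_num at e3
      have t := congrArg (fun z => (inner ℝ z x : ℝ)) (hparallel i j l hij hli hlj hne2)
      simp only [inner_smul_left, RCLike.conj_to_real] at t
      rw [hax, eq_comm] at t
      have t0 := (mul_eq_zero.1 t).resolve_left (mul_ne_zero three_ne_zero hne2)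
      rw [h_anti l i (Ne.symm hli), inner_neg_left, t0, neg_zero, zero_smul]
    obtain ⟨x, hx0, hx, hax⟩ := Quaternion.exists_re_eq_zero_and_inner_eq_zero (h i j)
    exact hx0 (hmul x hx hax)
  by_contra! hcard
  obtain ⟨i⟩ : Nonempty ι := Fintype.card_pos_iff.1 (by lia)
  -- By `hzero` the entries of row `i`, including `h i i = 1`, are pairwise orthogonal; more than
  -- four of them cannot all be nonzero in `ℍ`.
  obtain ⟨k, hik, hk⟩ : ∃ k, i ≠ k ∧ h i k = 0 := by
    by_contra! hall
    have hne : ∀ l, h i l ≠ 0 := by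
      intro l
      by_cases hl : i = l
      · subst hl
        simp [h_self]
      · exact hall l hl
    have hli : LinearIndependent ℝ (h i) := by
      refine linearIndependent_of_ne_zero_of_inner_eq_zero hne fun a b hab => ?_
      by_cases ha : i = a
      · subst ha
        simp [h_self, Quaternion.inner_def, h_re i b hab]
      by_cases hb : i = b
      · subst hb
        simp [h_self, Quaternion.inner_def, h_re i a ha]
      change (inner ℝ (h i a) (h i b) : ℝ) = 0
      rw [h_anti b i (Ne.symm hb), inner_neg_right, hzero i a b ha hb hab, neg_zero]
    have := hli.fintype_card_le_finrank
    rw [Quaternion.finrank_eq_four] at this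
    lia
  obtain ⟨l, hkl, hl⟩ : ∃ l, k ≠ l ∧ h k l ≠ 0 := by
    by_contra! hall
    obtain ⟨x, hx0, hx, -⟩ := Quaternion.exists_re_eq_zero_and_inner_eq_zero 1
    have t := hrow k x hx
    rw [Finset.sum_eq_single k (fun l _ hl => by rw [hall l hl.symm, smul_zero]) (by simp),
      h_self] at t
    apply hx0
    rw [t]
    simp [Quaternion.inner_def, hx]
  have hki : h k i = 0 := by rw [h_anti i k hik, hk, neg_zero]
  have hil : i ≠ l := by
    rintro rfl
    exact hl hki
  have hil0 : h i l = 0 := by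
    have h0 : (inner ℝ (h i k) (h l i) : ℝ) = 0 := by rw [hk, inner_zero_left]
    have t := (hnorm i k l hik hil hkl h0).2.2
    rw [hk, norm_zero, zero_mul, norm_eq_zero] at t
    rw [h_anti l i hil.symm, t, neg_zero]
  apply hl
  -- Every coefficient of `h k l` along row `i` vanishes: `h_curv` turns the generic one into an
  -- inner product with `h i k = 0`.
  rw [hrow i (h k l) (h_re k l hkl)]
  refine Finset.sum_eq_zero fun m _ => ?_
  by_cases him : i = m
  · subst him
    simp [h_self, Quaternion.inner_def, h_re k l hkl]
  by_cases hmk : m = k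
  · rw [hmk, hk, smul_zero]
  by_cases hml : m = l
  · rw [hml, hil0, smul_zero]
  rw [h_curv i m k l him hik hil hmk hml hkl, hk, inner_zero_left, zero_smul]

/-! ### Iterated directional derivatives. -/

section Calculus

variable {E : Type*} [NormedAddCommGroup E] [NormedSpace ℝ E]
  {V : Type*} [NormedAddCommGroup V] [NormedSpace ℝ V]
  {W : Type*} [NormedAddCommGroup W] [NormedSpace ℝ W]
  {Z : Type*} [NormedAddCommGroup Z] [NormedSpace ℝ Z]

/-- The derivative of `f` in the constant direction `e`. -/
noncomputable def dirDeriv (e : E) (f : E → V) (y : E) : V := fderiv ℝ f y e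

lemma ContDiffOn.dirDeriv {f : E → V} {U : Set E} (hf : ContDiffOn ℝ ∞ f U) (hU : IsOpen U)
    (e : E) : ContDiffOn ℝ ∞ (dirDeriv e f) U :=
  (hf.fderiv_of_isOpen hU (m := ∞) (by simp)).clm_apply contDiffOn_const

lemma ContDiffOn.differentiableAt_of_isOpen {f : E → V} {U : Set E} (hf : ContDiffOn ℝ ∞ f U)
    (hU : IsOpen U) {y : E} (hy : y ∈ U) : DifferentiableAt ℝ f y :=
  (hf.contDiffAt (hU.mem_nhds hy)).differentiableAt (by simp)

lemma dirDeriv_congr {f g : E → V} {U : Set E} (hU : IsOpen U) (h : Set.EqOn f g U) (e : E) :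
    Set.EqOn (dirDeriv e f) (dirDeriv e g) U := fun y hy => by
  rw [dirDeriv, dirDeriv, (h.eventuallyEq_of_mem (hU.mem_nhds hy)).fderiv_eq]

lemma dirDeriv_eq_zero {f : E → V} {U : Set E} (hU : IsOpen U) (h : ∀ y ∈ U, f y = 0) (e : E) :
    ∀ y ∈ U, dirDeriv e f y = 0 := fun y hy => by
  rw [dirDeriv_congr hU (g := fun _ => 0) h e hy]
  simp [dirDeriv]

lemma dirDeriv_comm {f : E → V} {U : Set E} (hf : ContDiffOn ℝ ∞ f U) (hU : IsOpen U)
    (a b : E) {y : E} (hy : y ∈ U) :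
    dirDeriv a (dirDeriv b f) y = dirDeriv b (dirDeriv a f) y := by
  have hd : DifferentiableAt ℝ (fderiv ℝ f) y :=
    (hf.fderiv_of_isOpen hU (m := ∞) (by simp)).differentiableAt_of_isOpen hU hy
  have key : ∀ a b : E, dirDeriv a (dirDeriv b f) y = fderiv ℝ (fderiv ℝ f) y a b := by
    intro a b
    have := (hd.hasFDerivAt.clm_apply (hasFDerivAt_const b y)).fderiv
    unfold dirDeriv
    rw [this]
    simp
  rw [key, key]
  exact ((hf.contDiffAt (hU.mem_nhds hy)).isSymmSndFDerivAt
    (by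
      simp only [minSmoothness_of_isRCLikeNormedField]
      exact WithTop.coe_le_coe.2 le_top)).eq a b

lemma dirDeriv_add {f g : E → V} {y : E} (hf : DifferentiableAt ℝ f y)
    (hg : DifferentiableAt ℝ g y) (e : E) :
    dirDeriv e (fun y => f y + g y) y = dirDeriv e f y + dirDeriv e g y := by
  simp only [dirDeriv]
  rw [fderiv_fun_add hf hg]
  rfl

lemma dirDeriv_clm (L : V →L[ℝ] W) {f : E → V} {y : E} (hf : DifferentiableAt ℝ f y) (e : E) :
    dirDeriv e (fun y => L (f y)) y = L (dirDeriv e f y) := by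
  change fderiv ℝ (L ∘ f) y e = L (fderiv ℝ f y e)
  rw [(L.hasFDerivAt.comp y hf.hasFDerivAt).fderiv]
  rfl

lemma dirDeriv_bilin (B : V →L[ℝ] W →L[ℝ] Z) {f : E → V} {g : E → W} {y : E}
    (hf : DifferentiableAt ℝ f y) (hg : DifferentiableAt ℝ g y) (e : E) :
    dirDeriv e (fun y => B (f y) (g y)) y = B (dirDeriv e f y) (g y) + B (f y) (dirDeriv e g y) := by
  simp only [dirDeriv]
  rw [(B.hasFDerivAt_of_bilinear hf.hasFDerivAt hg.hasFDerivAt).fderiv]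
  simp [add_comm]

lemma ContDiffOn.bilin (B : V →L[ℝ] W →L[ℝ] Z) {f : E → V} {g : E → W} {U : Set E}
    (hf : ContDiffOn ℝ ∞ f U) (hg : ContDiffOn ℝ ∞ g U) :
    ContDiffOn ℝ ∞ (fun y => B (f y) (g y)) U :=
  B.isBoundedBilinearMap.contDiff.comp_contDiffOn (hf.prodMk hg)

/-- The second derivative of a product. -/
lemma dirDeriv_dirDeriv_bilin (B : V →L[ℝ] W →L[ℝ] Z) {f : E → V} {g : E → W} {U : Set E}
    (hU : IsOpen U) (hf : ContDiffOn ℝ ∞ f U) (hg : ContDiffOn ℝ ∞ g U) (a b : E) {y : E}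
    (hy : y ∈ U) :
    dirDeriv a (dirDeriv b fun y => B (f y) (g y)) y
      = B (dirDeriv a (dirDeriv b f) y) (g y) + B (dirDeriv b f y) (dirDeriv a g y)
        + (B (dirDeriv a f y) (dirDeriv b g y) + B (f y) (dirDeriv a (dirDeriv b g) y)) := by
  have h1 : Set.EqOn (dirDeriv b fun y => B (f y) (g y))
      (fun y => B (dirDeriv b f y) (g y) + B (f y) (dirDeriv b g y)) U := fun z hz =>
    dirDeriv_bilin B (hf.differentiableAt_of_isOpen hU hz) (hg.differentiableAt_of_isOpen hU hz) b
  rw [dirDeriv_congr hU h1 a hy]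
  have d1 := ((hf.dirDeriv hU b).bilin B hg).differentiableAt_of_isOpen hU hy
  have d2 := (hf.bilin B (hg.dirDeriv hU b)).differentiableAt_of_isOpen hU hy
  rw [dirDeriv_add d1 d2, dirDeriv_bilin B ((hf.dirDeriv hU b).differentiableAt_of_isOpen hU hy)
    (hg.differentiableAt_of_isOpen hU hy), dirDeriv_bilin B (hf.differentiableAt_of_isOpen hU hy)
    ((hg.dirDeriv hU b).differentiableAt_of_isOpen hU hy)]

end Calculus

/-! ### Second-order consequences of orthogonality. -/

section OrthogonalFrames

variable {E : Type*} [NormedAddCommGroup E] [NormedSpace ℝ E]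
  {V : Type*} [NormedAddCommGroup V] [InnerProductSpace ℝ V]
  {K : Type*} [NormedAddCommGroup K] [InnerProductSpace ℝ K]

/-- If `w` is in the span of an orthogonal family `f`, orthogonal to every `f c` with `c ≠ i, k`,
then it is orthogonal to every vector which is orthogonal to `f i` and `f k`. -/
lemma inner_eq_zero_of_mem_span {ι : Type*} [Fintype ι] {f : ι → V}
    (hf : ∀ i j, i ≠ j → (inner ℝ (f i) (f j) : ℝ) = 0) {w z : V}
    (hw : w ∈ Submodule.span ℝ (Set.range f)) {i k : ι}
    (hwf : ∀ c, c ≠ i → c ≠ k → (inner ℝ w (f c) : ℝ) = 0)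
    (hi : (inner ℝ (f i) z : ℝ) = 0) (hk : (inner ℝ (f k) z : ℝ) = 0) : (inner ℝ w z : ℝ) = 0 := by
  obtain ⟨a, rfl⟩ := (Submodule.mem_span_range_iff_exists_fun ℝ).1 hw
  rw [sum_inner]
  refine Finset.sum_eq_zero fun d _ => ?_
  rw [real_inner_smul_left]
  by_cases hdi : d = i
  · rw [hdi, hi, mul_zero]
  by_cases hdk : d = k
  · rw [hdk, hk, mul_zero]
  have h := hwf d hdi hdk
  rw [sum_inner, Finset.sum_eq_single d (fun c _ hc => by
    rw [real_inner_smul_left, hf c d hc, mul_zero]) (by simp), real_inner_smul_left,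
    mul_eq_zero] at h
  rcases h with h | h
  · rw [h, zero_mul]
  · rw [inner_self_eq_zero.1 h, inner_zero_left, mul_zero]

/-- Let `F` map an open set to `V`, with `F y₀ = 0`, and suppose that the constant vector fields
`e i` are pairwise orthogonal for the pull-back by `F` of the symmetric form
`(X, Y) ↦ (m + ‖v‖²) ⟨X, Y⟩ - ⟨h (X, v), h (Y, v)⟩` at `v`. Then the third order Taylor expansion of
`F` at `y₀` constrains the products of the values of `h` on vectors with distinct indices. -/
theorem inner_bilin_dirDeriv_eq {ι : Type*} [Fintype ι] {U : Set E} (hU : IsOpen U) {y₀ : E}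
    (hy₀ : y₀ ∈ U) {F : E → V} (hF : ContDiffOn ℝ ∞ F U) (hF₀ : F y₀ = 0)
    (h : V →L[ℝ] V →L[ℝ] K) (e : ι → E) {m : ℝ} (hm : m ≠ 0)
    (horth : ∀ y ∈ U, ∀ i j, i ≠ j →
      (m + inner ℝ (F y) (F y)) * (inner ℝ (dirDeriv (e i) F y) (dirDeriv (e j) F y) : ℝ)
        = inner ℝ (h (dirDeriv (e i) F y) (F y)) (h (dirDeriv (e j) F y) (F y)))
    (hspan : ∀ i k, dirDeriv (e k) (dirDeriv (e i) F) y₀ ∈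
      Submodule.span ℝ (Set.range fun c => dirDeriv (e c) F y₀))
    (hanti : ∀ i j, i ≠ j → h (dirDeriv (e j) F y₀) (dirDeriv (e i) F y₀)
      = -h (dirDeriv (e i) F y₀) (dirDeriv (e j) F y₀))
    (i j k l : ι) (hij : i ≠ j) (hik : i ≠ k) (hil : i ≠ l) (hjk : j ≠ k) (hjl : j ≠ l)
    (hkl : k ≠ l) :
    (inner ℝ (h (dirDeriv (e i) F y₀) (dirDeriv (e j) F y₀))
        (h (dirDeriv (e k) F y₀) (dirDeriv (e l) F y₀)) : ℝ)
      = inner ℝ (h (dirDeriv (e i) F y₀) (dirDeriv (e k) F y₀))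
        (h (dirDeriv (e l) F y₀) (dirDeriv (e j) F y₀)) := by
  set f : ι → V := fun i => dirDeriv (e i) F y₀ with hf
  set S : ι → ι → V := fun k i => dirDeriv (e k) (dirDeriv (e i) F) y₀ with hS
  set T : ι → ι → ι → V := fun k l i => dirDeriv (e k) (dirDeriv (e l) (dirDeriv (e i) F)) y₀
    with hT
  have hG : ∀ i, ContDiffOn ℝ ∞ (dirDeriv (e i) F) U := fun i => hF.dirDeriv hU (e i)
  have hd : ∀ {g : E → V}, ContDiffOn ℝ ∞ g U → DifferentiableAt ℝ g y₀ :=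
    fun hg => hg.differentiableAt_of_isOpen hU hy₀
  have hSsymm : ∀ i k, S k i = S i k := fun i k => dirDeriv_comm hF hU _ _ hy₀
  have hT1 : ∀ k l i, T k l i = T l k i := fun k l i => dirDeriv_comm (hG i) hU _ _ hy₀
  have hT2 : ∀ k l i, T k l i = T k i l := fun k l i =>
    dirDeriv_congr hU (fun y hy => dirDeriv_comm hF hU _ _ hy) _ hy₀
  let N : E → ℝ := fun y => m + innerSL ℝ (F y) (F y)
  let Q : ι → ι → E → ℝ := fun i j y => innerSL ℝ (dirDeriv (e i) F y) (dirDeriv (e j) F y)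
  let A : ι → E → K := fun i y => h (dirDeriv (e i) F y) (F y)
  have hN : ContDiffOn ℝ ∞ N U := contDiffOn_const.add (hF.bilin (innerSL ℝ) hF)
  have hQ : ∀ i j, ContDiffOn ℝ ∞ (Q i j) U := fun i j => (hG i).bilin (innerSL ℝ) (hG j)
  have hA : ∀ i, ContDiffOn ℝ ∞ (A i) U := fun i => (hG i).bilin h hF
  have hN0 : N y₀ = m := by simp [N, hF₀]
  have hN1 : ∀ k, dirDeriv (e k) N y₀ = 0 := by
    intro k
    have : dirDeriv (e k) N y₀ = dirDeriv (e k) (fun y => innerSL ℝ (F y) (F y)) y₀ := by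
      simp only [dirDeriv, N]
      rw [fderiv_const_add]
    rw [this, dirDeriv_bilin _ (hd hF) (hd hF), hF₀]
    simp
  have hA0 : ∀ i, A i y₀ = 0 := fun i => by simp [A, hF₀]
  have hA1 : ∀ i k, dirDeriv (e k) (A i) y₀ = h (f i) (f k) := by
    intro i k
    simp only [A]
    rw [dirDeriv_bilin _ (hd (hG i)) (hd hF), hF₀, map_zero, zero_add]
  have hQ1 : ∀ i j k, dirDeriv (e k) (Q i j) y₀
      = inner ℝ (S k i) (f j) + inner ℝ (f i) (S k j) := by
    intro i j k
    simp only [Q]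
    rw [dirDeriv_bilin _ (hd (hG i)) (hd (hG j))]
    rfl
  have hQ2 : ∀ i j k l, dirDeriv (e k) (dirDeriv (e l) (Q i j)) y₀
      = inner ℝ (T k l i) (f j) + inner ℝ (S l i) (S k j)
        + (inner ℝ (S k i) (S l j) + inner ℝ (f i) (T k l j)) := by
    intro i j k l
    simp only [Q]
    rw [dirDeriv_dirDeriv_bilin _ hU (hG i) (hG j) _ _ hy₀]
    rfl
  have heq : ∀ i j, i ≠ j → Set.EqOn (fun y => ContinuousLinearMap.mul ℝ ℝ (N y) (Q i j y))
      (fun y => innerSL ℝ (A i y) (A j y)) U := fun i j hij y hy => horth y hy i j hij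
  have horth0 : ∀ i j, i ≠ j → (inner ℝ (f i) (f j) : ℝ) = 0 := by
    intro i j hij
    have h0 := heq i j hij hy₀
    simp only [hN0, hA0] at h0
    simpa [hm, Q] using h0
  have hfirst : ∀ i j k, i ≠ j → (inner ℝ (S k i) (f j) : ℝ) + inner ℝ (f i) (S k j) = 0 := by
    intro i j k hij
    have h1 := dirDeriv_congr hU (heq i j hij) (e k) hy₀
    rw [dirDeriv_bilin _ (hN.differentiableAt_of_isOpen hU hy₀)
      ((hQ i j).differentiableAt_of_isOpen hU hy₀), dirDeriv_bilin _ ((hA i).differentiableAt_of_isOpen hU hy₀)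
      ((hA j).differentiableAt_of_isOpen hU hy₀), hN0, hN1,
      hA0, hA0, hQ1] at h1
    simpa [hm] using h1
  have hsecond : ∀ i j k l, i ≠ j → m * ((inner ℝ (T k l i) (f j) : ℝ) + inner ℝ (S l i) (S k j)
        + (inner ℝ (S k i) (S l j) + inner ℝ (f i) (T k l j)))
      = inner ℝ (h (f i) (f l)) (h (f j) (f k)) + inner ℝ (h (f i) (f k)) (h (f j) (f l)) := by
    intro i j k l hij
    have h2 := dirDeriv_congr hU (dirDeriv_congr hU (heq i j hij) (e l)) (e k) hy₀
    rw [dirDeriv_dirDeriv_bilin _ hU hN (hQ i j) _ _ hy₀,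
      dirDeriv_dirDeriv_bilin _ hU (hA i) (hA j) _ _ hy₀, hN0, hN1, hN1, hA0, hA0, hA1, hA1, hA1,
      hA1, hQ2] at h2
    have hq : Q i j y₀ = 0 := horth0 i j hij
    rw [hq] at h2
    simp only [map_zero, zero_apply, zero_add, add_zero] at h2
    exact h2
  -- As in the Koszul formula: three cyclic first-order relations and the symmetry of `S`.
  have hS0 : ∀ i j k, i ≠ j → i ≠ k → j ≠ k → (inner ℝ (S k i) (f j) : ℝ) = 0 := by
    intro i j k hij hik hjk
    have a1 := hfirst i j k hij
    have a2 := hfirst j k i hjk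
    have a3 := hfirst k i j hik.symm
    rw [real_inner_comm (S k j)] at a1
    rw [real_inner_comm (S i k), hSsymm k i] at a2
    rw [real_inner_comm (S j i), hSsymm i j, hSsymm k j] at a3
    linarith
  -- By `hS0` and `hspan`, `S k i` has components only along `f i` and `f k`, both orthogonal to `S
  -- l j`.
  have hSS : ∀ i j k l, i ≠ j → i ≠ k → i ≠ l → j ≠ k → j ≠ l → k ≠ l →
      (inner ℝ (S k i) (S l j) : ℝ) = 0 := by
    intro i j k l hij hik hil hjk hjl hkl
    refine inner_eq_zero_of_mem_span (f := f) horth0 (hspan i k) (i := i) (k := k)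
      (fun c hci hck => hS0 i c k hci.symm hik hck) ?_ ?_
    · rw [real_inner_comm]
      exact hS0 j i l hij.symm hjl hil
    · rw [real_inner_comm]
      exact hS0 j k l hjk hjl hkl
  have key : ∀ i j k l, i ≠ j → i ≠ k → i ≠ l → j ≠ k → j ≠ l → k ≠ l →
      m * ((inner ℝ (T k l i) (f j) : ℝ) + inner ℝ (T k l j) (f i))
      = inner ℝ (h (f i) (f l)) (h (f j) (f k)) + inner ℝ (h (f i) (f k)) (h (f j) (f l)) := by
    intro i j k l hij hik hil hjk hjl hkl
    rw [← hsecond i j k l hij, hSS i j k l hij hik hil hjk hjl hkl,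
      hSS i j l k hij hil hik hjl hjk hkl.symm, real_inner_comm (f i)]
    ring
  -- There is one equation for each pair of indices. The third derivatives enter through four
  -- numbers, one per index, so the equations of complementary pairs have the same sum for all three
  -- splittings. Writing `P = ⟨h i j, h k l⟩`, `Q = ⟨h i k, h l j⟩`, `R = ⟨h i l, h j k⟩` for the
  -- values on the frame, this yields `R - Q = P - R = Q - P`. These differences add up to zero, so
  -- `P = Q = R`.
  have k1 := key i j k l hij hik hil hjk hjl hkl
  have k2 := key k l i j hkl hik.symm hjk.symm hil.symm hjl.symm hij
  have k3 := key i k j l hik hij hil hjk.symm hkl hjl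
  have k4 := key j l i k hjl hij.symm hjk hil.symm hkl.symm hik
  have k5 := key i l j k hil hij hik hjl.symm hkl.symm hjk
  have k6 := key j k i l hjk hij.symm hjl hik.symm hkl hil
  rw [hT1 i j l, hT2 j i l] at k2
  rw [hT1 j l k, hT2 l j k, hT1 l k j] at k3
  rw [hT2 i k j, hT1 i k l, hT2 k i l] at k4
  rw [hT2 j k i, hT1 j i k, hT1 j k l, hT2 k j l] at k5
  rw [hT1 i l j, hT2 l i j, hT1 l j i, hT1 i l k, hT2 l i k, hT1 l k i] at k6
  change (inner ℝ (h (f i) (f j)) (h (f k) (f l)) : ℝ) = inner ℝ (h (f i) (f k)) (h (f l) (f j))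
  have e : ∀ i j, i ≠ j → h (f j) (f i) = -h (f i) (f j) := hanti
  simp only [e i j hij, e i k hik, e i l hil, e j k hjk, e j l hjl, e k l hkl, inner_neg_left,
    inner_neg_right, neg_neg] at k1 k2 k3 k4 k5 k6 ⊢
  have c1 := real_inner_comm (h (f i) (f l)) (h (f j) (f k))
  have c2 := real_inner_comm (h (f i) (f k)) (h (f j) (f l))
  have c3 := real_inner_comm (h (f i) (f j)) (h (f k) (f l))
  linarith

end OrthogonalFrames

/-! ### The obstruction in an affine chart of `ℍP^q`. -/

namespace QProj

/-- The quaternionic Hermitian product as a real bilinear map. -/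
noncomputable def hermL (q : ℕ) : QSpace q →L[ℝ] QSpace q →L[ℝ] ℍ :=
  ∑ k : Fin q, (ContinuousLinearMap.mul ℝ ℍ).bilinearComp (PiLp.proj 2 (fun _ : Fin q => ℍ) k)
    (qstar.comp (PiLp.proj 2 (fun _ : Fin q => ℍ) k))

@[simp] lemma hermL_apply {q : ℕ} (v w : QSpace q) : hermL q v w = herm v w := by
  simp [hermL, herm, qstar]

variable {q : ℕ}

/-- Real adjunction between `a ↦ a • v` and `x ↦ herm x v`; it turns real coefficients in a basis
into entries of the Gram matrix. -/
lemma inner_smul_eq_inner_herm (x v : QSpace q) (a : ℍ) :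
    (inner ℝ x (a • v) : ℝ) = inner ℝ (herm x v) a := by
  simp only [PiLp.inner_apply, herm, sum_inner, Quaternion.inner_def, PiLp.smul_apply, smul_eq_mul,
    StarMul.star_mul, mul_assoc]

lemma re_herm (x v : QSpace q) : (herm x v).re = inner ℝ x v := by
  have := inner_smul_eq_inner_herm x v 1
  rw [one_smul] at this
  simp [this, Quaternion.inner_def]

lemma star_herm (x y : QSpace q) : star (herm x y) = herm y x := by
  simp [herm, star_sum]

lemma herm_quaternion_smul_left (a : ℍ) (x y : QSpace q) : herm (a • x) y = a * herm x y := by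
  simp [herm, Finset.mul_sum, mul_assoc]

lemma herm_quaternion_smul_right (a : ℍ) (x y : QSpace q) :
    herm x (a • y) = herm x y * star a := by
  simp [herm, Finset.sum_mul, mul_assoc]

lemma inner_hor_hor (v X Y : QSpace q) (hv : v ≠ 0) :
    (inner ℝ (hor v X) (hor v Y) : ℝ)
      = inner ℝ X Y - (‖v‖ ^ 2)⁻¹ * inner ℝ (herm X v) (herm Y v) := by
  have hv' : ‖v‖ ^ 2 ≠ 0 := pow_ne_zero 2 (norm_ne_zero_iff.2 hv)
  have e1 : (inner ℝ X (herm Y v • v) : ℝ) = inner ℝ (herm X v) (herm Y v) :=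
    inner_smul_eq_inner_herm X v _
  have e2 : (inner ℝ (herm X v • v) Y : ℝ) = inner ℝ (herm X v) (herm Y v) := by
    rw [real_inner_comm, inner_smul_eq_inner_herm, real_inner_comm]
  have e3 : (inner ℝ (herm X v • v) (herm Y v • v) : ℝ)
      = ‖v‖ ^ 2 * inner ℝ (herm X v) (herm Y v) := by
    rw [inner_smul_eq_inner_herm, herm_quaternion_smul_left, herm_self,
      ← Quaternion.coe_commutes, Quaternion.coe_mul_eq_smul, real_inner_smul_left]
  rw [hor_apply, hor_apply, inner_sub_left, inner_sub_right, inner_sub_right,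
    real_inner_smul_right, real_inner_smul_left, real_inner_smul_left, real_inner_smul_right,
    e1, e2, e3]
  field_simp
  ring

lemma herm_self_ne_zero {v : QSpace q} (hv : v ≠ 0) : herm v v ≠ 0 := by
  rw [herm_self]
  exact fun h => pow_ne_zero 2 (norm_ne_zero_iff.2 hv)
    (Quaternion.coe_injective (h.trans Quaternion.coe_zero.symm))

/-- Nonzero, pairwise orthogonal vectors which are as many as the real dimension of the quaternionic
orthogonal complement of `v` span this complement. -/
lemma span_eq_ker_herm {ι : Type*} [Fintype ι] (hι : Fintype.card ι = 4 * q) {v : QSpace (q + 1)}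
    (hv : v ≠ 0) {f : ι → QSpace (q + 1)} (hf0 : ∀ i, f i ≠ 0)
    (hf : ∀ i j, i ≠ j → (inner ℝ (f i) (f j) : ℝ) = 0) (hfv : ∀ i, herm (f i) v = 0) :
    Submodule.span ℝ (Set.range f) = LinearMap.ker ((hermL (q + 1)).flip v).toLinearMap := by
  have hli : LinearIndependent ℝ f :=
    linearIndependent_of_ne_zero_of_inner_eq_zero hf0 fun i j hij => hf i j hij
  apply Submodule.eq_of_le_of_finrank_eq
  · rw [Submodule.span_le]
    rintro _ ⟨i, rfl⟩
    simpa using hfv i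
  · have hsurj : LinearMap.range ((hermL (q + 1)).flip v).toLinearMap = ⊤ := by
      rw [LinearMap.range_eq_top]
      intro a
      refine ⟨(a * (herm v v)⁻¹) • v, ?_⟩
      simp [herm_quaternion_smul_left, herm_self_ne_zero hv]
    have h1 := LinearMap.finrank_range_add_finrank_ker ((hermL (q + 1)).flip v).toLinearMap
    rw [hsurj, finrank_top, Quaternion.finrank_eq_four, finrank_qSpace] at h1
    rw [finrank_span_eq_card hli, hι]
    exact (Nat.add_left_cancel (h1.trans (by ring : 4 * (q + 1) = 4 + 4 * q))).symm

/-- The pointwise obstruction: the curvature tensor of `ℍP^q`, `q ≥ 2`, does not vanish on all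
quadruples of distinct vectors of an orthogonal frame. -/
theorem le_one_of_orthogonal_frame {ι : Type*} [Fintype ι] [DecidableEq ι]
    (hι : Fintype.card ι = 4 * q) {v : QSpace (q + 1)} (hv : v ≠ 0) {f : ι → QSpace (q + 1)}
    (hf0 : ∀ i, f i ≠ 0) (hf : ∀ i j, i ≠ j → (inner ℝ (f i) (f j) : ℝ) = 0)
    (hfv : ∀ i, herm (f i) v = 0)
    (hcurv : ∀ i j k l, i ≠ j → i ≠ k → i ≠ l → j ≠ k → j ≠ l → k ≠ l →
      (inner ℝ (herm (f i) (f j)) (herm (f k) (f l)) : ℝ)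
        = inner ℝ (herm (f i) (f k)) (herm (f l) (f j))) :
    q ≤ 1 := by
  set e : ι → QSpace (q + 1) := fun i => (‖f i‖⁻¹ : ℝ) • f i with he
  have hn : ∀ i, ‖f i‖⁻¹ ≠ 0 := fun i => inv_ne_zero (norm_ne_zero_iff.2 (hf0 i))
  have he1 : ∀ i, ‖e i‖ = 1 := fun i => by
    rw [he, norm_smul, norm_inv, norm_norm, inv_mul_cancel₀ (norm_ne_zero_iff.2 (hf0 i))]
  have heo : Orthonormal ℝ e := by
    refine ⟨he1, fun i j hij => ?_⟩
    simp [he, real_inner_smul_left, real_inner_smul_right, hf i j hij]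
  have hev : ∀ i, herm (e i) v = 0 := fun i => by rw [he, herm_smul, hfv, smul_zero]
  have hspan := span_eq_ker_herm hι hv (fun i => smul_ne_zero (hn i) (hf0 i))
    (fun i j hij => heo.2 hij) hev
  have hexp : ∀ w, herm w v = 0 → ∑ l, (inner ℝ (e l) w : ℝ) • e l = w := by
    intro w hw
    have hmem : w ∈ Submodule.span ℝ (Set.range e) := by
      rw [hspan]
      simpa using hw
    obtain ⟨a, rfl⟩ := (Submodule.mem_span_range_iff_exists_fun ℝ).1 hmem
    refine Finset.sum_congr rfl fun l _ => ?_
    rw [heo.inner_right_fintype]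
  have hee : ∀ i j, herm (e i) (e j) = (‖f i‖⁻¹ * ‖f j‖⁻¹ : ℝ) • herm (f i) (f j) := by
    intro i j
    rw [← hermL_apply, ← hermL_apply, he]
    simp [smul_smul, mul_comm]
  have hre : ∀ i j, i ≠ j → (herm (e i) (e j)).re = 0 := fun i j hij => by
    rw [re_herm, heo.2 hij]
  have hcard := card_le_four_of_gram (h := fun i j => herm (e i) (e j))
    (fun i => by
      rw [herm_self, he1]
      simp)
    hre
    (fun i j hij => by
      rw [← star_herm, Quaternion.star_eq_neg_of_re_eq_zero (hre i j hij)])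
    -- The vector `x • e j` stays in the complement of `ℍ v`; its expansion in the orthonormal basis
    -- `e`, paired with `e k`, is the required identity.
    (fun j k x => by
      have h1 := hexp (x • e j) (by rw [herm_quaternion_smul_left, hev, mul_zero])
      rw [← herm_quaternion_smul_right, ← h1, ← hermL_apply, map_sum]
      refine Finset.sum_congr rfl fun l _ => ?_
      rw [map_smul, hermL_apply, inner_smul_eq_inner_herm])
    -- Each index occurs once on either side, so the relation survives the normalisation.
    (fun i j k l hij hik hil hjk hjl hkl => by
      simp only [hee, real_inner_smul_left, real_inner_smul_right,
        hcurv i j k l hij hik hil hjk hjl hkl]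
      ring)
  rw [hι] at hcard
  lia

/-- The orthogonality of the vectors `e i` for the pull-back of the standard metric, expressed in an
affine chart by a map `ψ`, is impossible in dimension `q ≥ 2`. -/
theorem le_one_of_orthogonal_chartForm {E : Type*} [NormedAddCommGroup E] [NormedSpace ℝ E]
    {ι : Type*} [Fintype ι] [DecidableEq ι] (hι : Fintype.card ι = 4 * q) (e : ι → E)
    {U : Set E} (hU : IsOpen U) {y₀ : E} (hy₀ : y₀ ∈ U) {ψ : E → QSpace q}
    (hψ : ContDiffOn ℝ ∞ ψ U) (i₀ : Fin (q + 1)) (hψ0 : ∀ i, dirDeriv (e i) ψ y₀ ≠ 0)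
    (horth : ∀ y ∈ U, ∀ i j, i ≠ j →
      chartForm i₀ (ψ y) (dirDeriv (e i) ψ y) (dirDeriv (e j) ψ y) = 0) :
    q ≤ 1 := by
  set s : E → QSpace (q + 1) := fun y => sec i₀ (ψ y) with hs
  set v := s y₀ with hv
  have hv0 : v ≠ 0 := sec_ne_zero i₀ _
  have hvv : herm v v ≠ 0 := herm_self_ne_zero hv0
  have hsU : ContDiffOn ℝ ∞ s U := (contDiff_sec i₀).comp_contDiffOn hψ
  have hsv : ContDiffOn ℝ ∞ (fun y => herm (s y) v) U := by
    have := ((hermL (q + 1)).flip v).contDiff.comp_contDiffOn hsU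
    refine this.congr fun y _ => ?_
    simp
  set U' : Set E := U ∩ {y | herm (s y) v ≠ 0} with hU'
  have hU'o : IsOpen U' := hsv.continuousOn.isOpen_inter_preimage hU isOpen_ne
  have hy₀' : y₀ ∈ U' := ⟨hy₀, hvv⟩
  -- The scalar that makes `herm (c y • s y) v = herm v v`: the rescaled lift stays in the affine
  -- subspace through `v` orthogonal to `ℍ v`.
  set c : E → ℍ := fun y => (‖v‖ ^ 2 : ℝ) • (herm (s y) v)⁻¹ with hc
  have hcU : ContDiffOn ℝ ∞ c U' := by
    intro y hy
    have h1 := contDiffAt_ringInverse (n := ∞) ℝ (Units.mk0 (herm (s y) v) hy.2)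
    rw [Ring.inverse_eq_inv'] at h1
    have h2 : ContDiffAt ℝ ∞ (fun y => (herm (s y) v)⁻¹) y :=
      ContDiffAt.comp y h1 (hsv.contDiffAt (hU.mem_nhds hy.1))
    exact (h2.const_smul (‖v‖ ^ 2 : ℝ)).contDiffWithinAt
  set F : E → QSpace (q + 1) := fun y => c y • s y - v with hF
  have hFU : ContDiffOn ℝ ∞ F U' :=
    (hcU.smul (hsU.mono Set.inter_subset_left)).sub contDiffOn_const
  have hFv : ∀ y ∈ U', (hermL (q + 1)).flip v (F y) = 0 := by
    intro y hy
    simp only [hF, map_sub, ContinuousLinearMap.flip_apply, hermL_apply,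
      herm_quaternion_smul_left, hc]
    rw [smul_mul_assoc, inv_mul_cancel₀ hy.2, herm_self, ← Quaternion.coe_mul_eq_smul, mul_one,
      sub_self]
  have hDFv : ∀ {G : E → QSpace (q + 1)}, ContDiffOn ℝ ∞ G U' →
      (∀ y ∈ U', (hermL (q + 1)).flip v (G y) = 0) → ∀ a, ∀ y ∈ U',
      (hermL (q + 1)).flip v (dirDeriv a G y) = 0 := by
    intro G hG hGv a y hy
    rw [← dirDeriv_clm _ (hG.differentiableAt_of_isOpen hU'o hy)]
    exact dirDeriv_eq_zero hU'o hGv a y hy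
  have hc0 : c y₀ = 1 := by
    simp only [hc]
    rw [← Quaternion.coe_mul_eq_smul, ← herm_self, mul_inv_cancel₀ hvv]
  have hF0 : F y₀ = 0 := by
    simp only [hF, hc0, one_smul]
    exact sub_self v
  have hder : ∀ y ∈ U', ∀ a, dirDeriv a F y
      = c y • ins i₀ (dirDeriv a ψ y) + (dirDeriv a c y) • s y := by
    intro y hy a
    have h1 : HasFDerivAt s ((ins i₀).comp (fderiv ℝ ψ y)) y :=
      (hasFDerivAt_sec i₀ (ψ y)).comp y (hψ.differentiableAt_of_isOpen hU hy.1).hasFDerivAt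
    have h2 := ((hcU.differentiableAt_of_isOpen hU'o hy).hasFDerivAt.smul h1).sub_const v
    have h3 := h2.fderiv
    simp only [dirDeriv]
    change fderiv ℝ (fun y => (c • s) y - v) y a = _
    rw [h3]
    simp
  have hforth : ∀ y ∈ U', ∀ i j, i ≠ j →
      (‖v‖ ^ 2 + inner ℝ (F y) (F y)) * (inner ℝ (dirDeriv (e i) F y) (dirDeriv (e j) F y) : ℝ)
        = inner ℝ (hermL (q + 1) (dirDeriv (e i) F y) (F y))
          (hermL (q + 1) (dirDeriv (e j) F y) (F y)) := by
    intro y hy i j hij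
    have hcy : c y ≠ 0 := smul_ne_zero (pow_ne_zero 2 (norm_ne_zero_iff.2 hv0)) (inv_ne_zero hy.2)
    have h1 := horth y hy.1 i j hij
    -- The horizontal form is unchanged by rescaling the lift, and the derivative of `c` contributes
    -- only a vertical term.
    rw [chartForm_apply, ← horForm_smul (c y) (dirDeriv (e i) c y) (dirDeriv (e j) c y) hcy _ _ _
      (sec_ne_zero i₀ _)] at h1
    change horForm (c y • s y) (_ + _ • s y) (_ + _ • s y) = 0 at h1
    have hne : c y • s y ≠ 0 := smul_ne_zero hcy (sec_ne_zero i₀ _)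
    have hne' : ‖c y • s y‖ ^ 2 ≠ 0 := pow_ne_zero 2 (norm_ne_zero_iff.2 hne)
    rw [← hder y hy, ← hder y hy, horForm_apply, inner_hor_hor _ _ _ hne, mul_eq_zero] at h1
    have h2 := h1.resolve_left (inv_ne_zero hne')
    have hsum : c y • s y = F y + v := (sub_add_cancel _ _).symm
    have hperp : (inner ℝ (F y) v : ℝ) = 0 := by
      have := hFv y hy
      rw [ContinuousLinearMap.flip_apply, hermL_apply] at this
      rw [← re_herm, this]
      rfl
    have hnorm : ‖c y • s y‖ ^ 2 = ‖v‖ ^ 2 + inner ℝ (F y) (F y) := by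
      rw [hsum, ← real_inner_self_eq_norm_sq, inner_add_left, inner_add_right, inner_add_right,
        real_inner_comm (F y) v, hperp, real_inner_self_eq_norm_sq, real_inner_self_eq_norm_sq]
      ring
    have hherm : ∀ a, herm (dirDeriv a F y) (c y • s y) = hermL (q + 1) (dirDeriv a F y) (F y) := by
      intro a
      have := hDFv hFU hFv a y hy
      rw [ContinuousLinearMap.flip_apply] at this
      rw [hsum, ← hermL_apply, map_add, this, add_zero]
    rw [hherm, hherm, sub_eq_zero] at h2
    rw [← hnorm, h2, mul_inv_cancel_left₀ hne']
  have hDF0 : ∀ i, dirDeriv (e i) F y₀ ≠ 0 := by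
    intro i h0
    rw [hder y₀ hy₀', hc0, one_smul] at h0
    -- The entry at `i₀` isolates the derivative of `c`, since `ins i₀` vanishes there and `sec i₀`
    -- is `1`.
    have h1 := congrArg (fun w : QSpace (q + 1) => w i₀) h0
    simp only [hs, PiLp.add_apply, ins_same, PiLp.smul_apply, sec_same, smul_eq_mul, mul_one,
      zero_add, PiLp.zero_apply] at h1
    rw [h1, zero_smul, add_zero] at h0
    apply hψ0 i
    ext1 k
    have h2 := congrArg (fun w : QSpace (q + 1) => w (i₀.succAbove k)) h0
    simpa using h2
  have hDFv0 : ∀ i, herm (dirDeriv (e i) F y₀) v = 0 := fun i => by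
    have := hDFv hFU hFv (e i) y₀ hy₀'
    rwa [ContinuousLinearMap.flip_apply, hermL_apply] at this
  have hm : ‖v‖ ^ 2 ≠ 0 := pow_ne_zero 2 (norm_ne_zero_iff.2 hv0)
  have horth0 : ∀ i j, i ≠ j →
      (inner ℝ (dirDeriv (e i) F y₀) (dirDeriv (e j) F y₀) : ℝ) = 0 := by
    intro i j hij
    have := hforth y₀ hy₀' i j hij
    rw [hF0, map_zero, map_zero, inner_zero_left, inner_zero_left, add_zero] at this
    exact (mul_eq_zero.1 this).resolve_left hm
  refine le_one_of_orthogonal_frame hι hv0 hDF0 horth0 hDFv0 fun i j k l hij hik hil hjk hjl hkl => ?_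
  have := inner_bilin_dirDeriv_eq hU'o hy₀' hFU hF0 (hermL (q + 1)) e hm hforth
    (fun i k => ?_) (fun i j hij => ?_) i j k l hij hik hil hjk hjl hkl
  · simpa using this
  -- All derivatives of `F` stay in the complement of `ℍ v`, which the first derivatives span by the
  -- dimension count.
  · rw [span_eq_ker_herm hι hv0 hDF0 horth0 hDFv0]
    exact hDFv (hFU.dirDeriv hU'o _) (hDFv hFU hFv _) _ _ hy₀'
  · rw [hermL_apply, hermL_apply, ← star_herm, Quaternion.star_eq_neg_of_re_eq_zero]
    rw [re_herm, horth0 i j hij]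

end QProj

/-! ### From coordinates on the manifold to a fixed affine chart. -/

namespace QProj

variable {q : ℕ}

/-- Local coordinates, read in an affine chart. -/
lemma contDiffOn_coord_symm {n : ℕ} {φ : OpenPartialHomeomorph (QProj q) (EuclideanSpace ℝ (Fin n))}
    (hφ : IsLocalCoordinates 𝓘(ℝ, QSpace q) φ) (i₀ : Fin (q + 1)) :
    ContDiffOn ℝ ∞ (fun y => coord i₀ (φ.symm y)) (φ.target ∩ φ.symm ⁻¹' dom i₀) := by
  rw [← contMDiffOn_iff_contDiffOn]
  exact (contMDiffOn_coord i₀).comp (hφ.2.mono Set.inter_subset_left) fun y hy => hy.2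

/-- Tangent vectors are stored in the preferred chart of their base point, so the chart on the right
depends on `y`. -/
lemma coordVector_eq_dirDeriv {n : ℕ}
    {φ : OpenPartialHomeomorph (QProj q) (EuclideanSpace ℝ (Fin n))}
    (hφ : IsLocalCoordinates 𝓘(ℝ, QSpace q) φ) {y : EuclideanSpace ℝ (Fin n)} (hy : y ∈ φ.target)
    (i : Fin n) :
    (coordVector 𝓘(ℝ, QSpace q) φ i y : QSpace q)
      = dirDeriv (EuclideanSpace.single i (1 : ℝ))
        (fun z => coord (idx (φ.symm y)) (φ.symm z)) y := by
  have hd : MDifferentiableAt 𝓘(ℝ, EuclideanSpace ℝ (Fin n)) 𝓘(ℝ, QSpace q) φ.symm y :=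
    (hφ.2.contMDiffAt (φ.open_target.mem_nhds hy)).mdifferentiableAt (by simp)
  unfold coordVector dirDeriv
  rw [hd.mfderiv]
  simp only [modelWithCornersSelf_coe, Set.range_id, fderivWithin_univ]
  rfl

/-- The coordinates `φ`, read in the chart, provide a differentiable left inverse, so the derivative
is injective. -/
lemma dirDeriv_coord_ne_zero {n : ℕ}
    {φ : OpenPartialHomeomorph (QProj q) (EuclideanSpace ℝ (Fin n))}
    (hφ : IsLocalCoordinates 𝓘(ℝ, QSpace q) φ) (i₀ : Fin (q + 1)) {y : EuclideanSpace ℝ (Fin n)}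
    (hy : y ∈ φ.target) (hy' : φ.symm y ∈ dom i₀) {a : EuclideanSpace ℝ (Fin n)} (ha : a ≠ 0) :
    dirDeriv a (fun z => coord i₀ (φ.symm z)) y ≠ 0 := by
  have hU : IsOpen (φ.target ∩ φ.symm ⁻¹' dom i₀) := φ.symm.isOpen_inter_preimage (isOpen_dom i₀)
  have hψ := (contDiffOn_coord_symm hφ i₀).differentiableAt_of_isOpen hU ⟨hy, hy'⟩
  have hx : (chart i₀).symm (coord i₀ (φ.symm y)) = φ.symm y := (chart i₀).left_inv hy'
  have hmax : chart i₀ ∈ IsManifold.maximalAtlas 𝓘(ℝ, QSpace q) ∞ (QProj q) :=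
    IsManifold.subset_maximalAtlas ⟨i₀, rfl⟩
  have hsymm : ContMDiffAt 𝓘(ℝ, QSpace q) 𝓘(ℝ, QSpace q) ∞ (chart i₀).symm
      (coord i₀ (φ.symm y)) :=
    (contMDiffOn_symm_of_mem_maximalAtlas hmax).contMDiffAt
      ((chart i₀).open_target.mem_nhds (Set.mem_univ _))
  have hφy : ContMDiffAt 𝓘(ℝ, QSpace q) 𝓘(ℝ, EuclideanSpace ℝ (Fin n)) ∞ φ
      ((chart i₀).symm (coord i₀ (φ.symm y))) := by
    rw [hx]
    exact hφ.1.contMDiffAt (φ.open_source.mem_nhds (φ.map_target hy))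
  have hinv : DifferentiableAt ℝ (fun x => φ ((chart i₀).symm x)) (coord i₀ (φ.symm y)) :=
    (contMDiffAt_iff_contDiffAt.1 (hφy.comp _ hsymm)).differentiableAt (by simp)
  have hcomp := hinv.hasFDerivAt.comp y hψ.hasFDerivAt
  have hid : (fun x => φ ((chart i₀).symm x)) ∘ (fun z => coord i₀ (φ.symm z)) =ᶠ[nhds y] id := by
    filter_upwards [hU.mem_nhds ⟨hy, hy'⟩] with z hz
    have : (chart i₀).symm (coord i₀ (φ.symm z)) = φ.symm z := (chart i₀).left_inv hz.2
    simp only [Function.comp_apply, this, id]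
    exact φ.right_inv hz.1
  have heq := (hcomp.congr_of_eventuallyEq hid.symm).unique (hasFDerivAt_id y)
  intro h0
  apply ha
  have := congrArg (fun A : EuclideanSpace ℝ (Fin n) →L[ℝ] EuclideanSpace ℝ (Fin n) => A a) heq
  simp only [ContinuousLinearMap.comp_apply, ContinuousLinearMap.id_apply] at this
  rw [← this]
  change fderiv ℝ (fun x => φ ((chart i₀).symm x)) _
    (dirDeriv a (fun z => coord i₀ (φ.symm z)) y) = 0
  rw [h0, map_zero]

/-- Orthogonal coordinates, read in an affine chart. -/
lemma chartForm_dirDeriv_eq_zero {n : ℕ}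
    {φ : OpenPartialHomeomorph (QProj q) (EuclideanSpace ℝ (Fin n))}
    (hφ : IsOrthogonalCoordinates (metric q) φ) (i₀ : Fin (q + 1)) {y : EuclideanSpace ℝ (Fin n)}
    (hy : y ∈ φ.target) (hy' : φ.symm y ∈ dom i₀) {i j : Fin n} (hij : i ≠ j) :
    chartForm i₀ (coord i₀ (φ.symm y))
      (dirDeriv (EuclideanSpace.single i (1 : ℝ)) (fun z => coord i₀ (φ.symm z)) y)
      (dirDeriv (EuclideanSpace.single j (1 : ℝ)) (fun z => coord i₀ (φ.symm z)) y) = 0 := by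
  -- Orthogonality is given in the preferred chart at the point; the invariance of `chartForm` under
  -- transition carries it to `i₀`, which must stay fixed while `y` varies.
  set k := idx (φ.symm y) with hk
  have hyk : φ.symm y ∈ dom k := mem_dom_idx _
  have hopen : ∀ l : Fin (q + 1), IsOpen (φ.target ∩ φ.symm ⁻¹' dom l) := fun l =>
    φ.symm.isOpen_inter_preimage (isOpen_dom l)
  have hmk : ∀ p ∈ dom k, mk ⟨sec k (coord k p), sec_ne_zero k _⟩ = p := fun p hp =>
    (chart k).left_inv hp
  have hne : sec k (coord k (φ.symm y)) i₀ ≠ 0 := by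
    rw [← hmk _ hyk] at hy'
    simpa using hy'
  have htrans : ∀ p ∈ dom k, aff i₀ (sec k (coord k p)) = coord i₀ p := fun p hp =>
    congrArg (coord i₀) (hmk p hp)
  have hcont : Continuous (fun x : QSpace q => sec k x i₀) :=
    (PiLp.continuous_apply 2 (fun _ : Fin (q + 1) => ℍ) i₀).comp (contDiff_sec (n := 0) k).continuous
  have hT : DifferentiableAt ℝ (fun x => aff i₀ (sec k x)) (coord k (φ.symm y)) :=
    ((contDiffOn_transition k i₀).differentiableAt_of_isOpen
      (isOpen_ne_fun hcont continuous_const) hne)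
  have hψk := (contDiffOn_coord_symm hφ.1 k).differentiableAt_of_isOpen (hopen k) ⟨hy, hyk⟩
  have hchain : ∀ a, dirDeriv a (fun z => coord i₀ (φ.symm z)) y
      = fderiv ℝ (fun x => aff i₀ (sec k x)) (coord k (φ.symm y))
        (dirDeriv a (fun z => coord k (φ.symm z)) y) := by
    intro a
    rw [← dirDeriv_congr (hopen k) (f := fun z => aff i₀ (sec k (coord k (φ.symm z))))
      (fun z hz => htrans _ hz.2) a ⟨hy, hyk⟩]
    have := (hT.hasFDerivAt.comp y hψk.hasFDerivAt).fderiv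
    exact congrArg (fun A : EuclideanSpace ℝ (Fin n) →L[ℝ] QSpace q => A a) this
  rw [hchain, hchain, ← htrans _ hyk, chartForm_transition k i₀ _ _ _ hne,
    ← coordVector_eq_dirDeriv hφ.1 hy i, ← coordVector_eq_dirDeriv hφ.1 hy j]
  exact hφ.2 y hy i j hij

end QProj

theorem proposition4p1 (q : ℕ) (hq : 2 ≤ q) :
    ¬ ∃ φ : OpenPartialHomeomorph (QProj q) (EuclideanSpace ℝ (Fin (4 * q))),
      φ.source.Nonempty ∧ IsOrthogonalCoordinates (QProj.metric q) φ := by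
  rintro ⟨φ, ⟨p, hp⟩, hφ⟩
  have hy : φ p ∈ φ.target := φ.map_source hp
  have hy' : φ.symm (φ p) ∈ QProj.dom (QProj.idx p) := by
    rw [φ.left_inv hp]
    exact QProj.mem_dom_idx p
  have := QProj.le_one_of_orthogonal_chartForm (Fintype.card_fin (4 * q))
    (fun i => EuclideanSpace.single i (1 : ℝ))
    (φ.symm.isOpen_inter_preimage (QProj.isOpen_dom (QProj.idx p))) ⟨hy, hy'⟩
    (QProj.contDiffOn_coord_symm hφ.1 (QProj.idx p)) (QProj.idx p)
    (fun i => QProj.dirDeriv_coord_ne_zero hφ.1 _ hy hy' (by simp))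
    (fun y hy i j hij => QProj.chartForm_dirDeriv_eq_zero hφ _ hy.1 hy.2 hij)
  lia
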